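/- Let $d\in\mathbb N$. For $z=(z_1,z_2)\in\mathbb R^{2d}$ let $\pi(z)f(t)=e^{2\pi i t\cdot z_2}f(t-z_1)$, and for $g\in\mathcal S(\mathbb R^d)\setminus\{0\}$, $f\in\mathcal S'(\mathbb R^d)$ let $V_gf(z)=\langle f,\pi(z)g\rangle$ be the short-time Fourier transform, where $\langle\cdot,\cdot\rangle$ extends $\int f\,\overline{g}\,dt$. For $s\ge 0$ put $v_s(z)=(1+|z|^2)^{s/2}$; a measurable function $m:\mathbb R^{2d}\to(0,\infty)$ is called $v_s$-moderate with constant $K$ if $m(z+\zeta)\le K\,v_s(z)\,m(\zeta)$ for all $z,\zeta\in\mathbb R^{2d}$. For $1\le p\le\infty$ let $M^p_m(\mathbb R^d)$ be the space of all $f\in\mathcal S'(\mathbb R^d)$ with $\|f\|_{M^p_m}=\|V_gf\cdot m\|_{L^p(\mathbb R^{2d})}<\infty$. Let $\mathcal A\in Sp(d,\mathbb R)$, and let $\mu(\mathcal A)$ be a metaplectic operator associated with $\mathcal A$, that is, a unitary operator on $L^2(\mathbb R^d)$ such that for every $z\in\mathbb R^{2d}$ there is $c_{\mathcal A,z}\in\mathbb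 C$ with $|c_{\mathcal A,z}|=1$ and $$\pi(\mathcal A z)=c_{\mathcal A,z}\,\mu(\mathcal A)\,\pi(z)\,\mu(\mathcal A)^{-1}.$$ Then $\mu(\mathcal A)$ extends to a weak-$*$ continuous linear operator on $\mathcal S'(\mathbb R^d)$, again denoted by $\mu(\mathcal A)$, and for every window $g\in\mathcal S(\mathbb R^d)\setminus\{0\}$, every $s\ge 0$ and every $K$ there is a constant $C<\infty$ (depending only on $d$, $\mu(\mathcal A)$, $g$, $s$, $K$) such that, for every $v_s$-moderate weight $m$ with constant $K$ and every $1\le p\le\infty$, $\mu(\mathcal A)$ maps $M^p_{m\circ\mathcal A}(\mathbb R^d)$ into $M^p_m(\mathbb R^d)$ and $$\|\mu(\mathcal A)f\|_{M^p_m}\le C\,\|f\|_{M^p_{m\circ\mathcal A}}\qquad\text{for all } f\in M^p_{m\circ\mathcal A}(\mathbb R^d).$$ -/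

import Mathlib

open MeasureTheory SchwartzMap Matrix
open scoped ENNReal NNReal

noncomputable section

namespace TimeFreq

/-- Configuration space `ℝ^d`, with its Euclidean norm and Lebesgue measure. -/
abbrev Config (d : ℕ) := EuclideanSpace ℝ (Fin d)

/-- Phase space `ℝ^{2d}`, with its Euclidean norm and Lebesgue measure. The first summand of the
index type carries the position `z₁`, the second one the frequency `z₂`. -/
abbrev Phase (d : ℕ) := EuclideanSpace ℝ (Fin d ⊕ Fin d)

/-- The position part `z₁` of `z = (z₁, z₂)`. -/
def pos {d : ℕ} (z : Phase d) : Config d := WithLp.toLp 2 fun i => z (Sum.inl i)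

/-- The frequency part `z₂` of `z = (z₁, z₂)`. -/
def freq {d : ℕ} (z : Phase d) : Config d := WithLp.toLp 2 fun i => z (Sum.inr i)

/-- The modulation factor `t ↦ e^{2πi t·z₂}`. -/
def modFactor {d : ℕ} (z : Phase d) (t : Config d) : ℂ :=
  Complex.exp ((2 * Real.pi * inner ℝ t (freq z) : ℝ) * Complex.I)

/-- The time-frequency shift on functions, `(π(z) f)(t) = e^{2πi t·z₂} f(t - z₁)`. -/
def tfShift {d : ℕ} (z : Phase d) (f : Config d → ℂ) : Config d → ℂ :=
  fun t => modFactor z t * f (t - pos z)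

theorem norm_modFactor {d : ℕ} (z : Phase d) (t : Config d) : ‖modFactor z t‖ = 1 :=
  Complex.norm_exp_ofReal_mul_I _

theorem continuous_modFactor {d : ℕ} (z : Phase d) : Continuous (modFactor z) := by
  unfold modFactor
  fun_prop

theorem iteratedDeriv_expI (n : ℕ) :
    iteratedDeriv n (fun x : ℝ => Complex.exp (x * Complex.I)) =
      fun x : ℝ => Complex.I ^ n * Complex.exp (x * Complex.I) := by
  induction n with
  | zero => simp
  | succ n ih =>
    rw [iteratedDeriv_succ, ih]
    funext x
    have h : HasDerivAt (fun y : ℝ => Complex.exp ((y : ℂ) * Complex.I))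
        (Complex.exp ((x : ℂ) * Complex.I) * (1 * Complex.I)) x :=
      ((Complex.ofRealCLM.hasDerivAt (x := x)).mul_const Complex.I).cexp
    rw [(h.const_mul (Complex.I ^ n)).deriv]
    ring

theorem hasTemperateGrowth_expI :
    Function.HasTemperateGrowth (fun x : ℝ => Complex.exp (x * Complex.I)) := by
  refine ⟨?_, fun n => ⟨0, 1, fun x => ?_⟩⟩
  · exact (Complex.ofRealCLM.contDiff.mul contDiff_const).cexp
  · rw [norm_iteratedFDeriv_eq_norm_iteratedDeriv, iteratedDeriv_expI]
    simp [Complex.norm_exp_ofReal_mul_I]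

theorem hasTemperateGrowth_modFactor {d : ℕ} (z : Phase d) :
    Function.HasTemperateGrowth (modFactor z) := by
  have h : Function.HasTemperateGrowth
      (fun t : Config d => 2 * Real.pi * inner ℝ t (freq z)) := by fun_prop
  exact hasTemperateGrowth_expI.comp h

theorem memLp_tfShift {d : ℕ} (z : Phase d) {f : Config d → ℂ} (hf : MemLp f 2 volume) :
    MemLp (tfShift z f) 2 volume := by
  have h : MemLp (fun t => f (t - pos z)) 2 volume :=
    hf.comp_measurePreserving (measurePreserving_sub_right volume (pos z))
  refine h.of_le ((continuous_modFactor z).aestronglyMeasurable.mul h.1)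
    (Filter.Eventually.of_forall fun t => ?_)
  simp [tfShift, norm_modFactor]

/-- The Hilbert space `L²(ℝ^d)`. -/
abbrev L2 (d : ℕ) := Lp ℂ 2 (volume : Measure (Config d))

/-- The time-frequency shift `π(z)` on `L²(ℝ^d)`. -/
def tfShiftL2 {d : ℕ} (z : Phase d) (f : L2 d) : L2 d :=
  (memLp_tfShift z (Lp.memLp f)).toLp (tfShift z f)

/-- The time-frequency shift `π(z)` on the Schwartz space. -/
def tfShiftS {d : ℕ} (z : Phase d) (g : 𝓢(Config d, ℂ)) : 𝓢(Config d, ℂ) :=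
  smulLeftCLM ℂ (modFactor z) (compSubConstCLM ℂ (pos z) g)

theorem tfShiftS_apply {d : ℕ} (z : Phase d) (g : 𝓢(Config d, ℂ)) (t : Config d) :
    tfShiftS z g t = tfShift z g t := by
  simp [tfShiftS, tfShift, smulLeftCLM_apply_apply (hasTemperateGrowth_modFactor z)]

/-- Complex conjugation on the Schwartz space. -/
def conjS {d : ℕ} (g : 𝓢(Config d, ℂ)) : 𝓢(Config d, ℂ) :=
  postcompCLM (𝕜 := ℝ) (Complex.conjCLE : ℂ →L[ℝ] ℂ) g

theorem conjS_apply {d : ℕ} (g : 𝓢(Config d, ℂ)) (t : Config d) :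
    conjS g t = starRingEnd ℂ (g t) := rfl

/-- The bracket `⟨f, φ⟩` on `𝓢' × 𝓢`, linear in `f` and antilinear in `φ`; it extends
`∫ f(t) conj(φ(t)) dt`. -/
def bracket {d : ℕ} (f : 𝓢'(Config d, ℂ)) (φ : 𝓢(Config d, ℂ)) : ℂ := f (conjS φ)

/-- The short-time Fourier transform `V_g f(z) = ⟨f, π(z) g⟩` of a tempered distribution. -/
def stft {d : ℕ} (g : 𝓢(Config d, ℂ)) (f : 𝓢'(Config d, ℂ)) (z : Phase d) : ℂ :=
  bracket f (tfShiftS z g)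

/-- The weight `v_s(z) = (1 + |z|²)^{s/2}` on phase space. -/
def polyWeight {d : ℕ} (s : ℝ) (z : Phase d) : ℝ := (1 + ‖z‖ ^ 2) ^ (s / 2)

/-- `m` is a `v_s`-moderate weight with moderateness constant `K`; the `v_s`-moderate weights are
the functions for which this holds for some `K`. -/
structure IsModerate {d : ℕ} (s K : ℝ) (m : Phase d → ℝ) : Prop where
  measurable : Measurable m
  pos : ∀ z, 0 < m z
  moderate : ∀ z ζ, m (z + ζ) ≤ K * polyWeight s z * m ζ

/-- The modulation space norm `‖f‖_{M^p_m} = ‖V_g f · m‖_{L^p}` for the window `g`, with value `∞`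
if `f` is not in the space. -/
def modNorm {d : ℕ} (g : 𝓢(Config d, ℂ)) (p : ℝ≥0∞) (m : Phase d → ℝ)
    (f : 𝓢'(Config d, ℂ)) : ℝ≥0∞ :=
  eLpNorm (fun z => stft g f z * (m z : ℂ)) p volume

/-- The modulation space `M^p_m(ℝ^d)`: the tempered distributions `f` with `V_g f · m ∈ L^p`. -/
def modSpace {d : ℕ} (g : 𝓢(Config d, ℂ)) (p : ℝ≥0∞) (m : Phase d → ℝ) :
    Submodule ℂ (𝓢'(Config d, ℂ)) where
  carrier := {f | MemLp (fun z => stft g f z * (m z : ℂ)) p volume}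
  zero_mem' := by
    have h : (fun z => stft g (0 : 𝓢'(Config d, ℂ)) z * (m z : ℂ)) = fun _ => 0 := by
      funext z
      change (0 : ℂ) * _ = 0
      simp
    change MemLp _ p volume
    rw [h]
    exact MemLp.zero
  add_mem' {f₁ f₂} h₁ h₂ := by
    have h : (fun z => stft g (f₁ + f₂) z * (m z : ℂ)) =
        (fun z => stft g f₁ z * (m z : ℂ)) + fun z => stft g f₂ z * (m z : ℂ) := by
      funext z
      change (stft g f₁ z + stft g f₂ z) * _ = _
      simp [add_mul]
    change MemLp _ p volume
    rw [h]
    exact MemLp.add h₁ h₂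
  smul_mem' c f hf := by
    have h : (fun z => stft g (c • f) z * (m z : ℂ)) =
        c • fun z => stft g f z * (m z : ℂ) := by
      funext z
      change (c * stft g f z) * _ = _
      simp [mul_assoc]
    change MemLp _ p volume
    rw [h]
    exact MemLp.const_smul hf c

/-- The action `z ↦ 𝒜 z` of a `2d × 2d` matrix on phase space. -/
def act {d : ℕ} (A : Matrix (Fin d ⊕ Fin d) (Fin d ⊕ Fin d) ℝ) (z : Phase d) : Phase d :=
  Matrix.toEuclideanLin A z

/-- The unitary operator `U` on `L²(ℝ^d)` is a metaplectic operator `μ(𝒜)` for the symplectic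
matrix `𝒜`: it satisfies the intertwining relation `π(𝒜 z) = c U π(z) U⁻¹` for all `z`, with phase
factors `c = c_{𝒜,z}` of modulus one. -/
def IsMetaplectic {d : ℕ} (A : Matrix.symplecticGroup (Fin d) ℝ) (U : L2 d ≃ₗᵢ[ℂ] L2 d) : Prop :=
  ∀ z : Phase d, ∃ c : ℂ, ‖c‖ = 1 ∧
    ∀ f : L2 d, tfShiftL2 (act (A : Matrix _ _ ℝ) z) f = c • U (tfShiftL2 z (U.symm f))

/-- `T` is the extension of the operator `U` from `L²(ℝ^d)` to `𝓢'(ℝ^d)`. As a member of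
`𝓢' →L[ℂ] 𝓢'` it is linear and weak-* continuous, hence determined by `U`, since `L²` is
weak-* dense in `𝓢'`. -/
def IsTemperedExtension {d : ℕ} (U : L2 d ≃ₗᵢ[ℂ] L2 d)
    (T : 𝓢'(Config d, ℂ) →L[ℂ] 𝓢'(Config d, ℂ)) : Prop :=
  ∀ f : L2 d, T (Lp.toTemperedDistribution f) = Lp.toTemperedDistribution (U f)

end TimeFreq

end

/-!
Let `P = μ(𝒜)⁻¹`. Since `P` intertwines time-frequency shifts up to phase factors, the ambiguity
function of `P φ` is that of `φ` composed with a linear map, up to phase factors, so it decays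
rapidly when `φ` is a Schwartz function, and by the inversion formula for the short-time Fourier
transform `P φ` is then again a Schwartz function. Thus `P` restricts to a continuous operator
on `𝓢`, whose adjoint on `𝓢'` is the extension of `μ(𝒜)`. The intertwining relation also gives
`|V_g (μ(𝒜) f)(𝒜 z)| = |V_{P g} f(z)|`, and `𝒜` preserves volume. So all that is left is to replace
the window `P g` by `g`: the two short-time Fourier transforms of `f` are related by an integral
kernel of rapid off-diagonal decay, which absorbs the moderate weight, and Schur's test bounds it
on all `L^p` at once.
-/

noncomputable section

namespace TimeFreq

open scoped ComplexConjugate FourierTransform ContDiff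

section SchurTest

variable {α β : Type*} [MeasurableSpace α] [MeasurableSpace β] {μ : Measure α} {ν : Measure β}

theorem rpow_lintegral_mul_le {f k : β → ℝ≥0∞} (hf : AEMeasurable f ν) (hk : AEMeasurable k ν)
    {r : ℝ} (hr : 1 ≤ r) :
    (∫⁻ z, f z * k z ∂ν) ^ r ≤ (∫⁻ z, k z ∂ν) ^ (r - 1) * ∫⁻ z, f z ^ r * k z ∂ν := by
  have hr0 : 0 < r := by linarith
  have hfk : AEMeasurable f (ν.withDensity k) :=
    hf.mono_ac (withDensity_absolutelyContinuous ν k)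
  have hdensity : ∀ {h : β → ℝ≥0∞}, AEMeasurable h ν →
      ∫⁻ z, h z ∂ν.withDensity k = ∫⁻ z, h z * k z ∂ν := fun hh => by
    simp only [lintegral_withDensity_eq_lintegral_mul₀ hk hh, Pi.mul_apply, mul_comm]
  have hjensen := eLpNorm'_le_eLpNorm'_mul_rpow_measure_univ zero_lt_one hr
    hfk.aestronglyMeasurable
  simp only [eLpNorm'_eq_lintegral_enorm, enorm_eq_self, ENNReal.rpow_one, div_one,
    withDensity_apply _ MeasurableSet.univ, Measure.restrict_univ, hdensity hf,
    hdensity (hf.pow_const r)] at hjensen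
  refine (ENNReal.rpow_le_rpow hjensen hr0.le).trans_eq ?_
  rw [ENNReal.mul_rpow_of_nonneg _ _ hr0.le, ← ENNReal.rpow_mul, ← ENNReal.rpow_mul,
    one_div_mul_cancel hr0.ne', ENNReal.rpow_one, mul_comm]
  congr 2
  field_simp

variable {E F : Type*} [NormedAddCommGroup E] [NormedAddCommGroup F]
  {a : α → E} {f : β → F} {k : α → β → ℝ≥0∞} {K : ℝ≥0∞}

theorem eLpNormEssSup_le_of_enorm_le_lintegral (hk : Measurable (Function.uncurry k))
    (hkν : ∀ w, ∫⁻ z, k w z ∂ν ≤ K) (ha : ∀ w, ‖a w‖ₑ ≤ ∫⁻ z, ‖f z‖ₑ * k w z ∂ν) :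
    eLpNormEssSup a μ ≤ K * eLpNormEssSup f ν := by
  refine eLpNormEssSup_le_of_ae_enorm_bound (.of_forall fun w => ?_)
  calc ‖a w‖ₑ ≤ ∫⁻ z, ‖f z‖ₑ * k w z ∂ν := ha w
    _ ≤ ∫⁻ z, eLpNormEssSup f ν * k w z ∂ν := by
      refine lintegral_mono_ae ?_
      filter_upwards [enorm_ae_le_eLpNormEssSup f ν] with z hz
      gcongr
    _ = (∫⁻ z, k w z ∂ν) * eLpNormEssSup f ν := by
      rw [lintegral_const_mul _ hk.of_uncurry_left, mul_comm]
    _ ≤ K * eLpNormEssSup f ν := by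
      gcongr
      exact hkν w

theorem lintegral_rpow_enorm_le_of_enorm_le_lintegral [SFinite μ] [SFinite ν]
    (hf : AEStronglyMeasurable f ν) (hk : Measurable (Function.uncurry k))
    (hkν : ∀ w, ∫⁻ z, k w z ∂ν ≤ K) (hkμ : ∀ z, ∫⁻ w, k w z ∂μ ≤ K)
    (ha : ∀ w, ‖a w‖ₑ ≤ ∫⁻ z, ‖f z‖ₑ * k w z ∂ν) {r : ℝ} (hr : 1 ≤ r) :
    ∫⁻ w, ‖a w‖ₑ ^ r ∂μ ≤ K ^ r * ∫⁻ z, ‖f z‖ₑ ^ r ∂ν := by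
  have hmeas : AEMeasurable (Function.uncurry fun w z => ‖f z‖ₑ ^ r * k w z) (μ.prod ν) :=
    (hf.comp_snd.enorm.pow_const r).mul hk.aemeasurable
  calc ∫⁻ w, ‖a w‖ₑ ^ r ∂μ
      ≤ ∫⁻ w, K ^ (r - 1) * ∫⁻ z, ‖f z‖ₑ ^ r * k w z ∂ν ∂μ := by
        refine lintegral_mono fun w => ?_
        refine (ENNReal.rpow_le_rpow (ha w) (by linarith)).trans
          ((rpow_lintegral_mul_le hf.enorm hk.of_uncurry_left.aemeasurable hr).trans ?_)
        gcongr
        exact hkν w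
    _ = K ^ (r - 1) * ∫⁻ z, ∫⁻ w, ‖f z‖ₑ ^ r * k w z ∂μ ∂ν := by
        rw [lintegral_const_mul'' _ hmeas.lintegral_prod_right, lintegral_lintegral_swap hmeas]
    _ ≤ K ^ (r - 1) * ∫⁻ z, ‖f z‖ₑ ^ r * K ∂ν := by
        gcongr with z
        rw [lintegral_const_mul _ hk.of_uncurry_right]
        gcongr
        exact hkμ z
    _ = K ^ r * ∫⁻ z, ‖f z‖ₑ ^ r ∂ν := by
        rw [lintegral_mul_const'' _ (hf.enorm.pow_const r), mul_comm _ K, ← mul_assoc]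
        nth_rewrite 2 [← ENNReal.rpow_one K]
        rw [← ENNReal.rpow_add_of_nonneg _ _ (by linarith) zero_le_one, sub_add_cancel]

theorem eLpNorm_le_of_schur_test [SFinite μ] [SFinite ν]
    (hf : AEStronglyMeasurable f ν) (hk : Measurable (Function.uncurry k))
    (hkν : ∀ w, ∫⁻ z, k w z ∂ν ≤ K) (hkμ : ∀ z, ∫⁻ w, k w z ∂μ ≤ K)
    (ha : ∀ w, ‖a w‖ₑ ≤ ∫⁻ z, ‖f z‖ₑ * k w z ∂ν) {p : ℝ≥0∞} (hp : 1 ≤ p) :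
    eLpNorm a p μ ≤ K * eLpNorm f p ν := by
  rcases eq_or_ne p ∞ with rfl | hp_top
  · exact eLpNormEssSup_le_of_enorm_le_lintegral hk hkν ha
  have hp_zero : p ≠ 0 := (zero_lt_one.trans_le hp).ne'
  have hr : 1 ≤ p.toReal := by simpa using ENNReal.toReal_mono hp_top hp
  have hr0 : 0 < p.toReal := by linarith
  rw [eLpNorm_eq_lintegral_rpow_enorm_toReal hp_zero hp_top,
    eLpNorm_eq_lintegral_rpow_enorm_toReal hp_zero hp_top]
  calc (∫⁻ w, ‖a w‖ₑ ^ p.toReal ∂μ) ^ (1 / p.toReal)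
      ≤ (K ^ p.toReal * ∫⁻ z, ‖f z‖ₑ ^ p.toReal ∂ν) ^ (1 / p.toReal) := by
        gcongr
        exact lintegral_rpow_enorm_le_of_enorm_le_lintegral hf hk hkν hkμ ha hr
    _ = K * (∫⁻ z, ‖f z‖ₑ ^ p.toReal ∂ν) ^ (1 / p.toReal) := by
        rw [ENNReal.mul_rpow_of_nonneg _ _ (by positivity), ← ENNReal.rpow_mul,
          mul_one_div_cancel hr0.ne', ENNReal.rpow_one]

end SchurTest

section FiniteMoments

theorem pow_mul_le_mul_rpow_neg {x y C : ℝ} (hx : 0 < x) {N M : ℕ} (h : x ^ (N + M) * y ≤ C) :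
    x ^ N * y ≤ C * x ^ (-(M : ℝ)) := by
  rw [Real.rpow_neg hx.le, Real.rpow_natCast, ← div_eq_mul_inv, le_div_iff₀ (by positivity)]
  rw [pow_add] at h
  linarith

variable {E F : Type*} [NormedAddCommGroup E] [MeasurableSpace E] [NormedAddCommGroup F]
  {μ : Measure E} {f : E → F}

theorem integral_pow_mul_norm_le [μ.HasTemperateGrowth] {N : ℕ} {C : ℝ}
    (h : ∀ x, (1 + ‖x‖) ^ (N + μ.integrablePower) * ‖f x‖ ≤ C) :
    ∫ x, (1 + ‖x‖) ^ N * ‖f x‖ ∂μ ≤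
      C * ∫ x, (1 + ‖x‖) ^ (-(μ.integrablePower : ℝ)) ∂μ := by
  rw [← integral_const_mul]
  exact integral_mono_of_nonneg (.of_forall fun x => by positivity)
    ((Measure.integrable_pow_neg_integrablePower μ).const_mul C)
    (.of_forall fun x => pow_mul_le_mul_rpow_neg (by positivity) (h x))

theorem memLp_two_inv_one_add_norm_pow [OpensMeasurableSpace E] [μ.HasTemperateGrowth] :
    MemLp (fun x : E => ((1 + ‖x‖) ^ μ.integrablePower)⁻¹) 2 μ := by
  have hc : Continuous fun x : E => ((1 + ‖x‖) ^ μ.integrablePower)⁻¹ :=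
    Continuous.inv₀ (by fun_prop) fun x => by positivity
  rw [memLp_two_iff_integrable_sq_norm hc.aestronglyMeasurable]
  refine (Measure.integrable_pow_neg_integrablePower μ).mono'
    (hc.norm.pow 2).aestronglyMeasurable (.of_forall fun x => ?_)
  rw [Real.rpow_neg (by positivity), Real.rpow_natCast, norm_pow, norm_norm,
    Real.norm_of_nonneg (by positivity)]
  exact pow_le_of_le_one (by positivity)
    (inv_le_one_of_one_le₀ (one_le_pow₀ (by linarith [norm_nonneg x]))) two_ne_zero

variable [NormedSpace ℝ F]

/-- `f` has finite moments of all orders: it is integrable against every polynomial weight. This is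
the decay of coefficients under which a superposition of time-frequency shifts is a Schwartz
function. -/
def HasFiniteMoments (f : E → F) (μ : Measure E := by volume_tac) : Prop :=
  ∀ N : ℕ, Integrable (fun x => (1 + ‖x‖) ^ N • f x) μ

theorem HasFiniteMoments.integrable (hf : HasFiniteMoments f μ) : Integrable f μ := by
  simpa using hf 0

theorem HasFiniteMoments.integrable_pow_mul_norm (hf : HasFiniteMoments f μ) (N : ℕ) :
    Integrable (fun x => (1 + ‖x‖) ^ N * ‖f x‖) μ := by
  refine (hf N).norm.congr (.of_forall fun x => ?_)
  simp only [norm_smul]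
  rw [Real.norm_of_nonneg (by positivity)]

theorem hasFiniteMoments_of_forall_pow_mul_norm_le [NormedSpace ℝ E]
    [FiniteDimensional ℝ E] [BorelSpace E] [μ.HasTemperateGrowth]
    (hf : AEStronglyMeasurable f μ) (h : ∀ N : ℕ, ∃ C, ∀ x, (1 + ‖x‖) ^ N * ‖f x‖ ≤ C) :
    HasFiniteMoments f μ := fun N => by
  obtain ⟨C, hC⟩ := h (N + μ.integrablePower)
  refine ((Measure.integrable_pow_neg_integrablePower μ).const_mul C).mono'
    (AEStronglyMeasurable.smul (by fun_prop) hf) (.of_forall fun x => ?_)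
  rw [norm_smul, Real.norm_of_nonneg (by positivity)]
  exact pow_mul_le_mul_rpow_neg (by positivity) (hC x)

end FiniteMoments

section DifferentiationUnderIntegral

variable {α E F : Type*} [MeasurableSpace α] {μ : Measure α} [NormedAddCommGroup E]
  [NormedSpace ℝ E] [NormedAddCommGroup F] [NormedSpace ℝ F]
  {G : α → E → F} {N : ℕ∞}

theorem curryLeft_integral [CompleteSpace F] {n : ℕ} {f : α → E [×n + 1]→L[ℝ] F}
    (hf : Integrable f μ) : (∫ a, f a ∂μ).curryLeft = ∫ a, (f a).curryLeft ∂μ :=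
  (ContinuousLinearMap.integral_comp_comm (𝕜 := ℝ) (Fₗ := E →L[ℝ] E [×n]→L[ℝ] F)
    (continuousMultilinearCurryLeftEquiv ℝ (fun _ : Fin (n + 1) => E)
      F).toLinearIsometry.toContinuousLinearMap hf).symm

theorem hasFDerivAt_iteratedFDeriv {f : E → F} (hf : ContDiff ℝ N f) {n : ℕ} (hn : n < N)
    (x : E) :
    HasFDerivAt (iteratedFDeriv ℝ n f) (iteratedFDeriv ℝ (n + 1) f x).curryLeft x :=
  (hf.differentiable_iteratedFDeriv (by exact_mod_cast hn) x).hasFDerivAt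

theorem hasFDerivAt_integral_iteratedFDeriv [CompleteSpace F] (hG : ∀ a, ContDiff ℝ N (G a))
    (hmeas : ∀ (n : ℕ) x, n ≤ N → AEStronglyMeasurable (fun a => iteratedFDeriv ℝ n (G a) x) μ)
    {bound : ℕ → α → ℝ} (hint : ∀ n : ℕ, n ≤ N → Integrable (bound n) μ)
    (hbound : ∀ (n : ℕ) a x, n ≤ N → ‖iteratedFDeriv ℝ n (G a) x‖ ≤ bound n a)
    {n : ℕ} (hn : n < N) (x : E) :
    HasFDerivAt (fun x => ∫ a, iteratedFDeriv ℝ n (G a) x ∂μ)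
      (∫ a, iteratedFDeriv ℝ (n + 1) (G a) x ∂μ).curryLeft x := by
  have hn' : ((n + 1 : ℕ) : ℕ∞) ≤ N := by exact_mod_cast Order.add_one_le_of_lt hn
  have hsucc : Integrable (fun a => iteratedFDeriv ℝ (n + 1) (G a) x) μ :=
    (hint _ hn').mono' (hmeas _ x hn') (.of_forall fun a => hbound _ a x hn')
  rw [curryLeft_integral hsucc]
  refine hasFDerivAt_integral_of_dominated_of_fderiv_le (𝕜 := ℝ) (s := Set.univ)
    (F' := fun x a => (iteratedFDeriv ℝ (n + 1) (G a) x).curryLeft) (bound := bound (n + 1))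
    Filter.univ_mem
    (.of_forall fun x => hmeas n x hn.le)
    ((hint n hn.le).mono' (hmeas n x hn.le) (.of_forall fun a => hbound n a x hn.le))
    ((continuousMultilinearCurryLeftEquiv ℝ (fun _ : Fin (n + 1) => E)
      F).continuous.comp_aestronglyMeasurable hsucc.1)
    (.of_forall fun a x _ => ?_) (hint _ hn')
    (.of_forall fun a x _ => hasFDerivAt_iteratedFDeriv (hG a) hn x)
  rw [ContinuousMultilinearMap.curryLeft_norm]
  exact hbound _ a x hn'

theorem hasFTaylorSeriesUpTo_integral [CompleteSpace F] (hG : ∀ a, ContDiff ℝ N (G a))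
    (hmeas : ∀ (n : ℕ) x, n ≤ N → AEStronglyMeasurable (fun a => iteratedFDeriv ℝ n (G a) x) μ)
    {bound : ℕ → α → ℝ} (hint : ∀ n : ℕ, n ≤ N → Integrable (bound n) μ)
    (hbound : ∀ (n : ℕ) a x, n ≤ N → ‖iteratedFDeriv ℝ n (G a) x‖ ≤ bound n a) :
    HasFTaylorSeriesUpTo N (fun x => ∫ a, G a x ∂μ)
      fun x n => ∫ a, iteratedFDeriv ℝ n (G a) x ∂μ := by
  refine ⟨fun x => ?_, fun n hn x => ?_, fun n hn => ?_⟩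
  · have hzero : Integrable (fun a => iteratedFDeriv ℝ 0 (G a) x) μ :=
      (hint 0 bot_le).mono' (hmeas 0 x bot_le) (.of_forall fun a => hbound 0 a x bot_le)
    refine ((ContinuousMultilinearMap.apply ℝ (fun _ : Fin 0 => E) F 0).integral_comp_comm
      hzero).symm.trans (integral_congr_ae (.of_forall fun a => ?_))
    simp
  · exact hasFDerivAt_integral_iteratedFDeriv hG hmeas hint hbound (by exact_mod_cast hn) x
  · have hn : (n : ℕ∞) ≤ N := by exact_mod_cast hn
    exact continuous_of_dominated (hmeas n · hn) (fun x => .of_forall fun a => hbound n a x hn)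
      (hint n hn) (.of_forall fun a => (hG a).continuous_iteratedFDeriv (by exact_mod_cast hn))

end DifferentiationUnderIntegral

section PolynomialWeights

theorem one_add_norm_le_mul_one_add_norm_sub {E : Type*} [SeminormedAddCommGroup E] (x y : E) :
    1 + ‖x‖ ≤ (1 + ‖y‖) * (1 + ‖x - y‖) := by
  have hxy : ‖x‖ ≤ ‖y‖ + ‖x - y‖ := norm_le_norm_add_norm_sub' x y
  nlinarith [mul_nonneg (norm_nonneg y) (norm_nonneg (x - y))]

theorem one_add_norm_map_le {𝕜 E F : Type*} [NontriviallyNormedField 𝕜]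
    [SeminormedAddCommGroup E] [NormedSpace 𝕜 E] [SeminormedAddCommGroup F] [NormedSpace 𝕜 F]
    (L : E →L[𝕜] F) (x : E) : 1 + ‖L x‖ ≤ (1 + ‖L‖) * (1 + ‖x‖) := by
  nlinarith [L.le_opNorm x, norm_nonneg x, norm_nonneg L]

end PolynomialWeights

section SchwartzSeminorms

variable {𝕜 E F : Type*} [RCLike 𝕜] [NormedAddCommGroup E] [NormedSpace ℝ E]
  [NormedAddCommGroup F] [NormedSpace ℝ F] [NormedSpace 𝕜 F] [SMulCommClass ℝ 𝕜 F]

theorem exists_continuous_seminorm_pow_mul_norm_le (N : ℕ) :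
    ∃ q : Seminorm 𝕜 𝓢(E, F), Continuous q ∧ ∀ f x, (1 + ‖x‖) ^ N * ‖f x‖ ≤ q f := by
  refine ⟨(2 ^ N : ℝ≥0) • (Finset.Iic (N, 0)).sup (schwartzSeminormFamily 𝕜 E F), ?_,
    fun f x => ?_⟩
  · exact (Seminorm.continuous_finsetSup fun i _ =>
      (schwartz_withSeminorms 𝕜 E F).continuous_seminorm i).const_smul (2 ^ N : ℝ≥0)
  · have h := one_add_le_sup_seminorm_apply (𝕜 := 𝕜) (m := (N, 0)) (k := N) le_rfl le_rfl f x
    rw [norm_iteratedFDeriv_zero] at h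
    rwa [_root_.smul_apply, NNReal.smul_def, NNReal.coe_pow, NNReal.coe_ofNat]

theorem exists_seminorm_le_of_forall_schwartz_seminorm_le {ι : Type*} {a : ι → 𝓢(E, F)}
    {B : ℕ → ι → ℝ} (hB : Monotone B) (hB0 : 0 ≤ B)
    (h : ∀ k n, ∃ C : ℝ, ∀ i, SchwartzMap.seminorm 𝕜 k n (a i) ≤ C * B (k + n) i)
    {q : Seminorm 𝕜 𝓢(E, F)} (hq : Continuous q) :
    ∃ (C : ℝ) (M : ℕ), ∀ i, q (a i) ≤ C * B M i := by
  obtain ⟨s, C, -, hqs⟩ := Seminorm.bound_of_continuous (schwartz_withSeminorms 𝕜 E F) q hq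
  choose D hD using h
  set M := s.sup fun j => j.1 + j.2
  refine ⟨C * ∑ j ∈ s, |D j.1 j.2|, M, fun i => (hqs (a i)).trans ?_⟩
  have hBM : 0 ≤ B M i := hB0 M i
  rw [_root_.smul_apply, NNReal.smul_def, smul_eq_mul, mul_assoc]
  gcongr
  refine Seminorm.finset_sup_apply_le (by positivity) fun j hj => ?_
  calc SchwartzMap.seminorm 𝕜 j.1 j.2 (a i) ≤ D j.1 j.2 * B (j.1 + j.2) i := hD _ _ i
    _ ≤ |D j.1 j.2| * B M i := by
      gcongr
      · exact hB0 _ i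
      · exact le_abs_self _
      · exact hB (Finset.le_sup (f := fun j : ℕ × ℕ => j.1 + j.2) hj) i
    _ ≤ (∑ j ∈ s, |D j.1 j.2|) * B M i := by
      gcongr
      exact Finset.single_le_sum (f := fun j => |D j.1 j.2|) (fun _ _ => abs_nonneg _) hj

theorem continuous_of_forall_schwartz_seminorm_le {G : Type*} [AddCommGroup G] [Module 𝕜 G]
    [TopologicalSpace G] [IsTopologicalAddGroup G] (L : G →ₗ[𝕜] 𝓢(E, F))
    (h : ∀ k n, ∃ (C : ℝ) (q : Seminorm 𝕜 G), Continuous q ∧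
      ∀ f, SchwartzMap.seminorm 𝕜 k n (L f) ≤ C * q f) : Continuous L := by
  refine (schwartz_withSeminorms 𝕜 E F).continuous_of_continuous_comp L fun i => ?_
  obtain ⟨C, q, hq, hLq⟩ := h i.1 i.2
  refine Seminorm.continuous_of_le (q := C.toNNReal • q) (hq.const_smul C.toNNReal) fun f => ?_
  rw [_root_.smul_apply, NNReal.smul_def, smul_eq_mul]
  exact (hLq f).trans (mul_le_mul_of_nonneg_right (Real.le_coe_toNNReal C) (apply_nonneg q f))

end SchwartzSeminorms

theorem continuous_iteratedFDeriv_prodMk {X E F : Type*} [NormedAddCommGroup X] [NormedSpace ℝ X]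
    [NormedAddCommGroup E] [NormedSpace ℝ E] [NormedAddCommGroup F] [NormedSpace ℝ F]
    {G : X × E → F} {n : ℕ} (hG : ContDiff ℝ n G) (t : E) :
    Continuous fun x => iteratedFDeriv ℝ n (fun s => G (x, s)) t := by
  have hslice : ∀ x, iteratedFDeriv ℝ n (fun s => G (x, s)) t =
      (iteratedFDeriv ℝ n G (x, t)).compContinuousLinearMap
        fun _ => ContinuousLinearMap.inr ℝ X E := fun x => by
    have hcomp : (fun s => G (x, s)) = (fun p => G ((x, 0) + p)) ∘
        ContinuousLinearMap.inr ℝ X E := by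
      funext s
      simp
    rw [hcomp, ContinuousLinearMap.iteratedFDeriv_comp_right _ (by fun_prop) _ le_rfl,
      iteratedFDeriv_comp_add_left]
    simp
  simp only [hslice]
  exact (ContinuousMultilinearMap.compContinuousLinearMapL (𝕜 := ℝ)
    (fun _ : Fin n => ContinuousLinearMap.inr ℝ X E)).continuous.comp
    ((hG.continuous_iteratedFDeriv le_rfl).comp (by fun_prop))

variable {d : ℕ}

section PhaseSpace

/-- The point `(x, η)` of phase space. -/
def phaseMk (x η : Config d) : Phase d := WithLp.toLp 2 (Sum.elim x η)

@[simp] theorem pos_phaseMk (x η : Config d) : pos (phaseMk x η) = x := rfl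

@[simp] theorem freq_phaseMk (x η : Config d) : freq (phaseMk x η) = η := rfl

/-- The splitting of phase space into positions and frequencies, as a measurable equivalence. -/
def phaseEquiv (d : ℕ) : Phase d ≃ᵐ Config d × Config d :=
  (MeasurableEquiv.toLp 2 (Fin d ⊕ Fin d → ℝ)).symm.trans
    ((MeasurableEquiv.sumPiEquivProdPi fun _ : Fin d ⊕ Fin d => ℝ).trans
      ((MeasurableEquiv.toLp 2 (Fin d → ℝ)).prodCongr (MeasurableEquiv.toLp 2 (Fin d → ℝ))))

theorem phaseEquiv_apply (z : Phase d) : phaseEquiv d z = (pos z, freq z) := rfl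

theorem measurePreserving_phaseEquiv (d : ℕ) : MeasurePreserving (phaseEquiv d) :=
  ((PiLp.volume_preserving_toLp (Fin d)).prod (PiLp.volume_preserving_toLp (Fin d))).comp
    ((volume_measurePreserving_sumPiEquivProdPi fun _ : Fin d ⊕ Fin d => ℝ).comp
      (PiLp.volume_preserving_ofLp (Fin d ⊕ Fin d)))

theorem norm_sq_eq_pos_add_freq (z : Phase d) : ‖z‖ ^ 2 = ‖pos z‖ ^ 2 + ‖freq z‖ ^ 2 := by
  simp [EuclideanSpace.norm_sq_eq, pos, freq]

theorem norm_pos_le (z : Phase d) : ‖pos z‖ ≤ ‖z‖ :=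
  le_of_sq_le_sq (by nlinarith [norm_sq_eq_pos_add_freq z]) (norm_nonneg z)

theorem norm_freq_le (z : Phase d) : ‖freq z‖ ≤ ‖z‖ := by
  nlinarith [norm_sq_eq_pos_add_freq z, norm_nonneg (freq z), norm_nonneg z, sq_nonneg ‖pos z‖]

theorem one_add_norm_le_pos_mul_freq (z : Phase d) :
    1 + ‖z‖ ≤ (1 + ‖pos z‖) * (1 + ‖freq z‖) := by
  have hz : ‖z‖ ≤ ‖pos z‖ + ‖freq z‖ := by
    refine (abs_le_of_sq_le_sq' ?_ (by positivity)).2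
    nlinarith [norm_sq_eq_pos_add_freq z, norm_nonneg (pos z), norm_nonneg (freq z)]
  nlinarith [mul_nonneg (norm_nonneg (pos z)) (norm_nonneg (freq z))]

@[fun_prop]
theorem contDiff_pos {n : WithTop ℕ∞} : ContDiff ℝ n (pos : Phase d → Config d) := by
  unfold pos
  fun_prop

@[fun_prop]
theorem contDiff_freq {n : WithTop ℕ∞} : ContDiff ℝ n (freq : Phase d → Config d) := by
  unfold freq
  fun_prop

@[fun_prop]
theorem continuous_pos : Continuous (pos : Phase d → Config d) :=
  (contDiff_pos (n := 0)).continuous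

end PhaseSpace

section TimeFrequencyShifts

theorem modFactor_eq_fourierChar (z : Phase d) (t : Config d) :
    modFactor z t = (Real.fourierChar (inner ℝ t (freq z)) : ℂ) := by
  rw [modFactor, Real.fourierChar_apply]

theorem modFactor_add_left (z w : Phase d) (t : Config d) :
    modFactor (z + w) t = modFactor z t * modFactor w t := by
  have hfreq : freq (z + w) = freq z + freq w := rfl
  simp only [modFactor_eq_fourierChar, hfreq, inner_add_right, AddChar.map_add_eq_mul,
    Circle.coe_mul]

theorem modFactor_sub_right (z : Phase d) (s t : Config d) :
    modFactor z (s - t) = modFactor z s * conj (modFactor z t) := by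
  simp only [modFactor_eq_fourierChar, inner_sub_left, AddChar.map_sub_eq_div, div_eq_mul_inv,
    Circle.coe_mul, Circle.coe_inv_eq_conj]

theorem contDiff_uncurry_modFactor {n : WithTop ℕ∞} :
    ContDiff ℝ n fun p : Phase d × Config d => modFactor p.1 p.2 := by
  have hphase : ContDiff ℝ n fun p : Phase d × Config d =>
      2 * Real.pi * inner ℝ p.2 (freq p.1) :=
    contDiff_const.mul (contDiff_snd.inner ℝ (contDiff_freq.comp contDiff_fst))
  exact ((Complex.ofRealCLM.contDiff.comp hphase).mul contDiff_const).cexp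

theorem norm_tfShift (z : Phase d) (f : Config d → ℂ) (t : Config d) :
    ‖tfShift z f t‖ = ‖f (t - pos z)‖ := by
  simp [tfShift, norm_modFactor]

theorem tfShift_tfShift (z w : Phase d) (f : Config d → ℂ) :
    tfShift z (tfShift w f) = conj (modFactor w (pos z)) • tfShift (z + w) f := by
  have hpos : pos (z + w) = pos z + pos w := rfl
  funext t
  simp only [tfShift, Pi.smul_apply, smul_eq_mul, modFactor_sub_right, modFactor_add_left, hpos,
    sub_sub]
  ring

theorem tfShift_eq_smul_tfShift_sub (z w : Phase d) (f : Config d → ℂ) :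
    tfShift w f = modFactor (w - z) (pos z) • tfShift z (tfShift (w - z) f) := by
  rw [tfShift_tfShift, smul_smul, Complex.mul_conj', norm_modFactor, add_sub_cancel]
  simp

theorem tfShift_ae_congr (z : Phase d) {f g : Config d → ℂ} (h : f =ᵐ[volume] g) :
    tfShift z f =ᵐ[volume] tfShift z g := by
  filter_upwards [(measurePreserving_sub_right volume (pos z)).quasiMeasurePreserving.ae h]
    with t ht
  simp only [tfShift, ht]

theorem stronglyMeasurable_uncurry_tfShift {f : Config d → ℂ} (hf : StronglyMeasurable f) :
    StronglyMeasurable fun p : Phase d × Config d => tfShift p.1 f p.2 :=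
  (contDiff_uncurry_modFactor (n := 0)).continuous.stronglyMeasurable.mul
    (hf.comp_measurable (Continuous.measurable (by fun_prop)))

theorem contDiff_uncurry_tfShift {n : WithTop ℕ∞} {f : Config d → ℂ} (hf : ContDiff ℝ n f) :
    ContDiff ℝ n fun p : Phase d × Config d => tfShift p.1 f p.2 :=
  contDiff_uncurry_modFactor.mul (hf.comp (by fun_prop))

theorem coe_tfShiftS (z : Phase d) (g : 𝓢(Config d, ℂ)) : ⇑(tfShiftS z g) = tfShift z g :=
  funext (tfShiftS_apply z g)

theorem norm_iteratedFDeriv_modFactor_le (z : Phase d) (n : ℕ) (t : Config d) :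
    ‖iteratedFDeriv ℝ n (modFactor z) t‖ ≤ (2 * Real.pi * ‖z‖) ^ n := by
  let L : Config d →L[ℝ] ℝ := (2 * Real.pi) • innerSL ℝ (freq z)
  have hL : ‖L‖ ≤ 2 * Real.pi * ‖z‖ := by
    simp only [L, norm_smul, innerSL_apply_norm]
    rw [Real.norm_of_nonneg (by positivity)]
    gcongr
    exact norm_freq_le z
  have hcomp : modFactor z = (fun x : ℝ => Complex.exp (x * Complex.I)) ∘ L := by
    funext t
    simp [modFactor, L, real_inner_comm]
  rw [hcomp, L.iteratedFDeriv_comp_right hasTemperateGrowth_expI.1 t (i := n) (mod_cast le_top)]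
  refine (ContinuousMultilinearMap.norm_compContinuousLinearMap_le _ _).trans ?_
  rw [norm_iteratedFDeriv_eq_norm_iteratedDeriv, iteratedDeriv_expI]
  simp only [norm_mul, norm_pow, Complex.norm_I, one_pow, Complex.norm_exp_ofReal_mul_I, one_mul,
    Finset.prod_const, Finset.card_univ, Fintype.card_fin]
  gcongr

theorem norm_iteratedFDeriv_tfShift_le (g : 𝓢(Config d, ℂ)) (z : Phase d) (n : ℕ) (t : Config d) :
    ‖iteratedFDeriv ℝ n (tfShift z g) t‖ ≤ ∑ i ∈ Finset.range (n + 1),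
      (n.choose i : ℝ) * (2 * Real.pi * ‖z‖) ^ i *
        ‖iteratedFDeriv ℝ (n - i) g (t - pos z)‖ := by
  have hleibniz := norm_iteratedFDeriv_mul_le (𝕜 := ℝ) (N := ∞) (f := modFactor z)
    (g := fun s => g (s - pos z)) (hasTemperateGrowth_modFactor z).1
    ((g.smooth ⊤).comp (by fun_prop)) t (n := n) (mod_cast le_top)
  refine hleibniz.trans (Finset.sum_le_sum fun i _ => ?_)
  rw [iteratedFDeriv_comp_sub]
  gcongr
  exact norm_iteratedFDeriv_modFactor_le z i t

theorem seminorm_tfShiftS_le (k n : ℕ) (z : Phase d) (g : 𝓢(Config d, ℂ)) :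
    SchwartzMap.seminorm ℂ k n (tfShiftS z g) ≤ 2 ^ k * (1 + 2 * Real.pi) ^ n *
      (Finset.Iic (k, n)).sup (schwartzSeminormFamily ℂ (Config d) ℂ) g *
        (1 + ‖z‖) ^ (k + n) := by
  set S := (Finset.Iic (k, n)).sup (schwartzSeminormFamily ℂ (Config d) ℂ) g
  have : 0 ≤ S := apply_nonneg _ _
  refine seminorm_le_bound ℂ k n _ (by positivity) fun t => ?_
  have ht : ‖t‖ ≤ (1 + ‖z‖) * (1 + ‖t - pos z‖) := by
    have hsub := one_add_norm_le_mul_one_add_norm_sub t (pos z)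
    nlinarith [norm_pos_le z, norm_nonneg (t - pos z)]
  have hg : ∀ i, (1 + ‖t - pos z‖) ^ k * ‖iteratedFDeriv ℝ (n - i) g (t - pos z)‖ ≤ 2 ^ k * S :=
    fun i => one_add_le_sup_seminorm_apply (𝕜 := ℂ) (m := (k, n)) le_rfl (Nat.sub_le n i) g _
  rw [coe_tfShiftS]
  calc ‖t‖ ^ k * ‖iteratedFDeriv ℝ n (tfShift z g) t‖
      ≤ ((1 + ‖z‖) * (1 + ‖t - pos z‖)) ^ k * ∑ i ∈ Finset.range (n + 1),
          (n.choose i : ℝ) * (2 * Real.pi * ‖z‖) ^ i *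
            ‖iteratedFDeriv ℝ (n - i) g (t - pos z)‖ := by
        gcongr
        exact norm_iteratedFDeriv_tfShift_le g z n t
    _ = (1 + ‖z‖) ^ k * ∑ i ∈ Finset.range (n + 1), (n.choose i : ℝ) * (2 * Real.pi * ‖z‖) ^ i *
          ((1 + ‖t - pos z‖) ^ k * ‖iteratedFDeriv ℝ (n - i) g (t - pos z)‖) := by
        rw [mul_pow, mul_assoc, Finset.mul_sum]
        congr 1
        exact Finset.sum_congr rfl fun i _ => by ring
    _ ≤ (1 + ‖z‖) ^ k * ∑ i ∈ Finset.range (n + 1),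
          (n.choose i : ℝ) * (2 * Real.pi * ‖z‖) ^ i * (2 ^ k * S) := by
        refine mul_le_mul_of_nonneg_left (Finset.sum_le_sum fun i _ => ?_) (by positivity)
        exact mul_le_mul_of_nonneg_left (hg i) (by positivity)
    _ = (1 + ‖z‖) ^ k * (2 * Real.pi * ‖z‖ + 1) ^ n * (2 ^ k * S) := by
        rw [← Finset.sum_mul, ← mul_assoc, add_pow (2 * Real.pi * ‖z‖) 1 n]
        simp only [one_pow, mul_one, mul_comm (Nat.cast _ : ℝ)]
    _ ≤ (1 + ‖z‖) ^ k * ((1 + 2 * Real.pi) * (1 + ‖z‖)) ^ n * (2 ^ k * S) := by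
        gcongr
        nlinarith [norm_nonneg z, Real.pi_pos]
    _ = 2 ^ k * (1 + 2 * Real.pi) ^ n * S * (1 + ‖z‖) ^ (k + n) := by
        rw [mul_pow, pow_add]
        ring

theorem exists_norm_pow_mul_iteratedFDeriv_smul_tfShift_le (k n : ℕ) (g : 𝓢(Config d, ℂ)) :
    ∃ C : ℝ, ∀ (c : ℂ) z t, ‖t‖ ^ k * ‖iteratedFDeriv ℝ n (c • tfShift z g) t‖ ≤
      C * ((1 + ‖z‖) ^ (k + n) * ‖c‖) := by
  refine ⟨2 ^ k * (1 + 2 * Real.pi) ^ n *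
    (Finset.Iic (k, n)).sup (schwartzSeminormFamily ℂ (Config d) ℂ) g, fun c z t => ?_⟩
  have h := (c • tfShiftS z g).le_seminorm ℂ k n t
  rw [map_smul_eq_mul, mul_comm ‖c‖] at h
  rw [← coe_tfShiftS, ← mul_assoc]
  exact h.trans (mul_le_mul_of_nonneg_right (seminorm_tfShiftS_le k n z g) (norm_nonneg c))

end TimeFrequencyShifts

section L2Pairing

variable {α : Type*} [MeasureSpace α] {f f' g g' : α → ℂ}

/-- The sesquilinear pairing `∫ f ḡ`, linear in the first argument as the brackets `⟨·, ·⟩` of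
time-frequency analysis. -/
def l2Pairing (f g : α → ℂ) : ℂ := ∫ t, f t * conj (g t)

theorem conj_l2Pairing (f g : α → ℂ) : conj (l2Pairing f g) = l2Pairing g f := by
  simp only [l2Pairing, ← integral_conj, map_mul, RCLike.conj_conj, mul_comm]

theorem l2Pairing_smul_left (c : ℂ) (f g : α → ℂ) : l2Pairing (c • f) g = c * l2Pairing f g := by
  simp only [l2Pairing, Pi.smul_apply, smul_eq_mul, mul_assoc, integral_const_mul]

theorem l2Pairing_smul_right (c : ℂ) (f g : α → ℂ) :
    l2Pairing f (c • g) = conj c * l2Pairing f g := by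
  rw [← conj_l2Pairing, l2Pairing_smul_left, map_mul, conj_l2Pairing]

theorem l2Pairing_congr_ae (hf : f =ᵐ[volume] f') (hg : g =ᵐ[volume] g') :
    l2Pairing f g = l2Pairing f' g' :=
  integral_congr_ae (hf.mul (hg.fun_comp conj))

theorem integrable_mul_conj (hf : MemLp f 2) (hg : MemLp g 2) :
    Integrable fun t => f t * conj (g t) :=
  hf.integrable_mul hg.star

theorem l2Pairing_eq_inner (hf : MemLp f 2) (hg : MemLp g 2) :
    l2Pairing f g = inner ℂ (hg.toLp g) (hf.toLp f) := by
  rw [L2.inner_def]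
  refine l2Pairing_congr_ae hf.coeFn_toLp.symm hg.coeFn_toLp.symm

theorem norm_l2Pairing_le (hf : MemLp f 2) (hg : MemLp g 2) :
    ‖l2Pairing f g‖ ≤ (eLpNorm f 2).toReal * (eLpNorm g 2).toReal := by
  rw [l2Pairing_eq_inner hf hg, mul_comm, ← Lp.norm_toLp f hf, ← Lp.norm_toLp g hg]
  exact norm_inner_le_norm _ _

end L2Pairing

section ShortTimeFourierTransform

variable {f g : Config d → ℂ}

theorem l2Pairing_tfShift_tfShift (z : Phase d) (f g : Config d → ℂ) :
    l2Pairing (tfShift z f) (tfShift z g) = l2Pairing f g := by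
  rw [l2Pairing, l2Pairing, ← integral_sub_right_eq_self (fun t => f t * conj (g t)) (pos z)]
  congr 1
  funext t
  rw [tfShift, tfShift, map_mul, mul_mul_mul_comm, Complex.mul_conj', norm_modFactor]
  simp

theorem eLpNorm_tfShift (z : Phase d) (hf : AEStronglyMeasurable f) (p : ℝ≥0∞) :
    eLpNorm (tfShift z f) p = eLpNorm f p := by
  rw [← eLpNorm_comp_measurePreserving hf (measurePreserving_sub_right volume (pos z))]
  exact eLpNorm_congr_norm_ae (.of_forall fun t => norm_tfShift z f t)

/-- The short-time Fourier transform `V_g f(z) = ⟨f, π(z) g⟩` of a function `f`. -/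
def stftFun (g f : Config d → ℂ) (z : Phase d) : ℂ := l2Pairing f (tfShift z g)

theorem stftFun_congr_ae {f' g' : Config d → ℂ} (hg : g =ᵐ[volume] g') (hf : f =ᵐ[volume] f') :
    stftFun g f = stftFun g' f' :=
  funext fun z => l2Pairing_congr_ae hf (tfShift_ae_congr z hg)

theorem stronglyMeasurable_stftFun (hg : AEStronglyMeasurable g) (hf : AEStronglyMeasurable f) :
    StronglyMeasurable (stftFun g f) := by
  rw [stftFun_congr_ae hg.ae_eq_mk hf.ae_eq_mk]
  exact StronglyMeasurable.integral_prod_right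
    (f := fun z t => hf.mk f t * conj (tfShift z (hg.mk g) t))
    ((hf.stronglyMeasurable_mk.comp_measurable measurable_snd).mul
      (stronglyMeasurable_uncurry_tfShift hg.stronglyMeasurable_mk).star)

theorem stftFun_eq_fourier (g f : Config d → ℂ) (z : Phase d) :
    stftFun g f z = 𝓕 (fun t => f t * conj (g (t - pos z))) (freq z) := by
  rw [stftFun, l2Pairing, Real.fourier_eq]
  congr 1
  funext t
  simp only [tfShift, modFactor_eq_fourierChar, map_mul, AddChar.map_neg_eq_inv, Circle.smul_def,
    smul_eq_mul, Circle.coe_inv_eq_conj]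
  ring

theorem stftFun_tfShift (g f : Config d → ℂ) (z w : Phase d) :
    stftFun g (tfShift z f) w = conj (modFactor (w - z) (pos z)) * stftFun g f (w - z) := by
  rw [stftFun, tfShift_eq_smul_tfShift_sub z w, l2Pairing_smul_right, l2Pairing_tfShift_tfShift,
    stftFun]

theorem norm_stftFun_tfShift (g f : Config d → ℂ) (z w : Phase d) :
    ‖stftFun g (tfShift z f) w‖ = ‖stftFun g f (w - z)‖ := by
  rw [stftFun_tfShift, norm_mul, RCLike.norm_conj, norm_modFactor, one_mul]

theorem norm_stftFun_le (hg : MemLp g 2) (hf : MemLp f 2) (z : Phase d) :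
    ‖stftFun g f z‖ ≤ (eLpNorm f 2).toReal * (eLpNorm g 2).toReal := by
  rw [← eLpNorm_tfShift z hg.1]
  exact norm_l2Pairing_le hf (memLp_tfShift z hg)

theorem one_add_norm_pos_pow_mul_norm_stftFun_le {N : ℕ} {C : ℝ}
    (hf : ∀ t, (1 + ‖t‖) ^ N * ‖f t‖ ≤ C) (hg : HasFiniteMoments g) (z : Phase d) :
    (1 + ‖pos z‖) ^ N * ‖stftFun g f z‖ ≤ C * ∫ t, (1 + ‖t‖) ^ N * ‖g t‖ := by
  rw [← integral_sub_right_eq_self (fun t => (1 + ‖t‖) ^ N * ‖g t‖) (pos z), ← integral_const_mul,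
    ← Real.norm_of_nonneg (by positivity : 0 ≤ (1 + ‖pos z‖) ^ N), ← norm_smul, stftFun, l2Pairing,
    ← integral_smul]
  refine norm_integral_le_of_norm_le
    (((hg.integrable_pow_mul_norm N).comp_sub_right (pos z)).const_mul C) (.of_forall fun t => ?_)
  rw [norm_smul, norm_mul, RCLike.norm_conj, norm_tfShift, Real.norm_of_nonneg (by positivity)]
  calc (1 + ‖pos z‖) ^ N * (‖f t‖ * ‖g (t - pos z)‖)
      ≤ ((1 + ‖t‖) * (1 + ‖t - pos z‖)) ^ N * (‖f t‖ * ‖g (t - pos z)‖) := by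
        gcongr
        simpa only [norm_sub_rev] using one_add_norm_le_mul_one_add_norm_sub (pos z) t
    _ = (1 + ‖t‖) ^ N * ‖f t‖ * ((1 + ‖t - pos z‖) ^ N * ‖g (t - pos z)‖) := by
        rw [mul_pow]
        ring
    _ ≤ C * ((1 + ‖t - pos z‖) ^ N * ‖g (t - pos z)‖) := by
        gcongr
        exact hf t

theorem hasFiniteMoments_schwartz (g : 𝓢(Config d, ℂ)) : HasFiniteMoments g := by
  refine hasFiniteMoments_of_forall_pow_mul_norm_le g.continuous.aestronglyMeasurable fun N => ?_
  obtain ⟨q, -, hq⟩ :=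
    exists_continuous_seminorm_pow_mul_norm_le (𝕜 := ℂ) (E := Config d) (F := ℂ) N
  exact ⟨q g, hq g⟩

theorem fourier_tfShift (z : Phase d) (f : Config d → ℂ) :
    𝓕 (tfShift z f) = (Real.fourierChar (inner ℝ (pos z) (freq z)) : ℂ) •
      tfShift (phaseMk (freq z) (-pos z)) (𝓕 f) := by
  funext ξ
  rw [Real.fourier_eq, ← integral_add_right_eq_self _ (pos z), Pi.smul_apply, tfShift,
    modFactor_eq_fourierChar, Real.fourier_eq, smul_eq_mul, ← mul_assoc, ← integral_const_mul]
  congr 1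
  funext t
  simp only [tfShift, modFactor_eq_fourierChar, Circle.smul_def, smul_eq_mul,
    add_sub_cancel_right, pos_phaseMk, freq_phaseMk]
  simp only [← mul_assoc, ← Circle.coe_mul, ← AddChar.map_add_eq_mul]
  congr 3
  simp only [inner_add_left, inner_sub_right, inner_neg_right, real_inner_comm ξ (pos z)]
  ring

theorem l2Pairing_fourier_fourier {F : Config d → ℂ} (hF : Integrable F) (G : 𝓢(Config d, ℂ)) :
    l2Pairing (𝓕 F) (𝓕 (G : Config d → ℂ)) = l2Pairing F G := by
  have hinv : ∀ x, VectorFourier.fourierIntegral Real.fourierChar volume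
      (-(innerₗ (Config d)).flip) (𝓕 G : 𝓢(Config d, ℂ)) x = G x := fun x => by
    have hG : (𝓕⁻ (𝓕 G : 𝓢(Config d, ℂ)) : 𝓢(Config d, ℂ)) x = G x := by simp
    rw [← hG, fourierInv_coe]
    simp [Real.fourierInv_eq, VectorFourier.fourierIntegral, real_inner_comm]
  have h := VectorFourier.integral_sesq_fourierIntegral_eq_neg_flip (innerSL ℂ (E := ℂ))
    (L := innerₗ (Config d)) Real.continuous_fourierChar continuous_inner hF
    ((𝓕 G : 𝓢(Config d, ℂ)).integrable (μ := volume))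
  simp only [hinv, innerSL_apply_apply, RCLike.inner_apply] at h
  rw [← conj_l2Pairing, ← conj_l2Pairing (G : Config d → ℂ)]
  exact congrArg conj h

theorem norm_stftFun_fourier (g f : 𝓢(Config d, ℂ)) (z : Phase d) :
    ‖stftFun (𝓕 (g : Config d → ℂ)) (𝓕 (f : Config d → ℂ)) (phaseMk (freq z) (-pos z))‖ =
      ‖stftFun g f z‖ := by
  have h := l2Pairing_fourier_fourier f.integrable (tfShiftS z g)
  rw [coe_tfShiftS, fourier_tfShift, l2Pairing_smul_right] at h
  rw [stftFun, stftFun, ← h, norm_mul, RCLike.norm_conj, Circle.norm_coe, one_mul]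

theorem exists_continuous_seminorm_pow_mul_norm_stftFun_le (g : 𝓢(Config d, ℂ)) (N : ℕ) :
    ∃ q : Seminorm ℂ 𝓢(Config d, ℂ), Continuous q ∧
      ∀ (f : 𝓢(Config d, ℂ)) z, (1 + ‖z‖) ^ N * ‖stftFun g f z‖ ≤ q f := by
  obtain ⟨q, hq, hqf⟩ :=
    exists_continuous_seminorm_pow_mul_norm_le (𝕜 := ℂ) (E := Config d) (F := ℂ) (2 * N)
  have hpos : ∀ (g f : 𝓢(Config d, ℂ)) z, (1 + ‖pos z‖) ^ (2 * N) * ‖stftFun g f z‖ ≤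
      (∫ t, (1 + ‖t‖) ^ (2 * N) * ‖g t‖).toNNReal * q f := fun g f z => by
    rw [Real.coe_toNNReal _ (by positivity), mul_comm _ (q f)]
    exact one_add_norm_pos_pow_mul_norm_stftFun_le (hqf f) (hasFiniteMoments_schwartz g) z
  let F := fourierTransformCLM ℂ (V := Config d) (E := ℂ)
  refine ⟨(∫ t, (1 + ‖t‖) ^ (2 * N) * ‖g t‖).toNNReal • q +
    (∫ t, (1 + ‖t‖) ^ (2 * N) * ‖𝓕 g t‖).toNNReal • q.comp F.toLinearMap,
    (hq.const_smul _).add ((hq.comp F.continuous).const_smul _), fun f z => ?_⟩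
  have hfreq := hpos (𝓕 g) (𝓕 f) (phaseMk (freq z) (-pos z))
  simp only [fourier_coe, norm_stftFun_fourier, pos_phaseMk] at hfreq
  have hpow : (1 + ‖z‖) ^ N ≤ (1 + ‖pos z‖) ^ (2 * N) + (1 + ‖freq z‖) ^ (2 * N) := by
    have hz := pow_le_pow_left₀ (by positivity) (one_add_norm_le_pos_mul_freq z) N
    rw [mul_pow] at hz
    rw [pow_mul', pow_mul']
    nlinarith [sq_nonneg ((1 + ‖pos z‖) ^ N - (1 + ‖freq z‖) ^ N)]
  refine (mul_le_mul_of_nonneg_right hpow (norm_nonneg _)).trans ?_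
  rw [add_mul]
  exact add_le_add (hpos g f z) hfreq

theorem hasFiniteMoments_stftFun (g f : 𝓢(Config d, ℂ)) : HasFiniteMoments (stftFun g f) := by
  refine hasFiniteMoments_of_forall_pow_mul_norm_le (stronglyMeasurable_stftFun
    g.continuous.aestronglyMeasurable f.continuous.aestronglyMeasurable).aestronglyMeasurable
    fun N => ?_
  obtain ⟨q, -, hq⟩ := exists_continuous_seminorm_pow_mul_norm_stftFun_le g N
  exact ⟨q f, hq f⟩

end ShortTimeFourierTransform

section Moyal

variable {f g : Config d → ℂ}

theorem integrable_stftFun_mul_conj (hg : MemLp g 2) (hf : MemLp f 2) (g' f' : 𝓢(Config d, ℂ)) :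
    Integrable fun z => stftFun g f z * conj (stftFun g' f' z) :=
  (Complex.conjCLE.integrable_comp_iff.2 (hasFiniteMoments_stftFun g' f').integrable).bdd_mul
    (stronglyMeasurable_stftFun hg.1 hf.1).aestronglyMeasurable (.of_forall (norm_stftFun_le hg hf))

theorem integral_freq_stftFun_mul_conj (hg : MemLp g 2) (hf : MemLp f 2) (g' f' : 𝓢(Config d, ℂ))
    (x : Config d) :
    ∫ η, stftFun g f (phaseMk x η) * conj (stftFun g' f' (phaseMk x η)) =
      ∫ t, f t * conj (f' t) * conj (g (t - x) * conj (g' (t - x))) := by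
  have hF : Integrable fun t => f t * conj (g (t - x)) :=
    integrable_mul_conj hf (hg.comp_measurePreserving (measurePreserving_sub_right volume x))
  let G : 𝓢(Config d, ℂ) := pairing (ContinuousLinearMap.mul ℂ ℂ) f'
    (conjS (compSubConstCLM ℂ x g'))
  have hG : ⇑G = fun t => f' t * conj (g' (t - x)) := by
    funext t
    simp [G, conjS_apply]
  have hparseval := l2Pairing_fourier_fourier hF G
  rw [hG] at hparseval
  simp only [stftFun_eq_fourier, pos_phaseMk, freq_phaseMk]
  refine hparseval.trans (integral_congr_ae (.of_forall fun t => ?_))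
  simp only [map_mul, RCLike.conj_conj]
  ring

theorem integral_integral_mul_comp_sub {a b : Config d → ℂ} (ha : Integrable a)
    (hb : Integrable b) : ∫ x, ∫ t, a t * b (t - x) = (∫ t, a t) * ∫ t, b t := by
  simpa [MeasureTheory.convolution, integral_neg_eq_self b volume] using
    integral_convolution (ContinuousLinearMap.mul ℂ ℂ) ha hb.comp_neg

theorem l2Pairing_stftFun_stftFun (hg : MemLp g 2) (hf : MemLp f 2) (g' f' : 𝓢(Config d, ℂ)) :
    l2Pairing (stftFun g f) (stftFun g' f') = l2Pairing f f' * conj (l2Pairing g g') := by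
  let Φ : Config d × Config d → ℂ := fun p =>
    stftFun g f (phaseMk p.1 p.2) * conj (stftFun g' f' (phaseMk p.1 p.2))
  have hΦ : (fun z => stftFun g f z * conj (stftFun g' f' z)) = Φ ∘ phaseEquiv d := by
    funext z
    simp [Φ, stftFun_eq_fourier, phaseEquiv_apply]
  have hmp := measurePreserving_phaseEquiv d
  have hint : Integrable Φ := by
    rw [← hmp.integrable_comp_emb (phaseEquiv d).measurableEmbedding, ← hΦ]
    exact integrable_stftFun_mul_conj hg hf g' f'
  calc l2Pairing (stftFun g f) (stftFun g' f')
      = ∫ p, Φ p := by rw [l2Pairing, hΦ, ← hmp.integral_comp']; rfl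
    _ = ∫ x, ∫ t, f t * conj (f' t) * conj (g (t - x) * conj (g' (t - x))) := by
        rw [Measure.volume_eq_prod, integral_prod _ hint]
        simp only [Φ, integral_freq_stftFun_mul_conj hg hf]
    _ = l2Pairing f f' * conj (l2Pairing g g') := by
        rw [integral_integral_mul_comp_sub (integrable_mul_conj hf (f'.memLp 2))
          (Complex.conjCLE.integrable_comp_iff.2 (integrable_mul_conj hg (g'.memLp 2)))
          (b := fun t => conj (g t * conj (g' t))),
          integral_conj, l2Pairing, l2Pairing]

end Moyal

section Synthesis

variable {F : Phase d → ℂ}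

theorem aestronglyMeasurable_iteratedFDeriv_smul_tfShift (hF : AEStronglyMeasurable F)
    (g : 𝓢(Config d, ℂ)) (n : ℕ) (t : Config d) :
    AEStronglyMeasurable fun z => iteratedFDeriv ℝ n (F z • tfShift z g) t := by
  have hsmooth : ContDiff ℝ n fun p : Phase d × Config d => tfShift p.1 g p.2 :=
    contDiff_uncurry_tfShift (g.smooth n)
  have hderiv : ∀ z, iteratedFDeriv ℝ n (F z • tfShift z g) t =
      F z • iteratedFDeriv ℝ n (tfShift z g) t := fun z =>
    iteratedFDeriv_const_smul_apply (hsmooth.comp (contDiff_prodMk_right z)).contDiffAt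
  simp only [hderiv]
  exact hF.smul (continuous_iteratedFDeriv_prodMk hsmooth t).aestronglyMeasurable

theorem hasFTaylorSeriesUpTo_integral_mul_tfShift (g : 𝓢(Config d, ℂ)) (hF : HasFiniteMoments F) :
    HasFTaylorSeriesUpTo ∞ (fun t => ∫ z, F z * tfShift z g t)
      fun t n => ∫ z, iteratedFDeriv ℝ n (F z • tfShift z g) t := by
  choose C hC using fun n => exists_norm_pow_mul_iteratedFDeriv_smul_tfShift_le 0 n g
  have hsmooth : ContDiff ℝ ∞ fun p : Phase d × Config d => tfShift p.1 g p.2 :=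
    contDiff_uncurry_tfShift (g.smooth ⊤)
  have hslice : ∀ z, ContDiff ℝ ∞ (F z • tfShift z g) := fun z =>
    (hsmooth.comp (contDiff_prodMk_right z)).const_smul (F z)
  exact hasFTaylorSeriesUpTo_integral (G := fun z => F z • tfShift z g) (N := ⊤) hslice
    (fun n t _ => aestronglyMeasurable_iteratedFDeriv_smul_tfShift hF.integrable.1 g n t)
    (fun n _ => (hF.integrable_pow_mul_norm (0 + n)).const_mul (C n))
    fun n z t _ => by simpa only [pow_zero, one_mul] using hC n (F z) z t

theorem exists_norm_pow_mul_iteratedFDeriv_integral_mul_tfShift_le (k n : ℕ)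
    (g : 𝓢(Config d, ℂ)) :
    ∃ C : ℝ, ∀ F : Phase d → ℂ, HasFiniteMoments F → ∀ t,
      ‖t‖ ^ k * ‖iteratedFDeriv ℝ n (fun s => ∫ z, F z * tfShift z g s) t‖ ≤
        C * ∫ z, (1 + ‖z‖) ^ (k + n) * ‖F z‖ := by
  obtain ⟨C, hC⟩ := exists_norm_pow_mul_iteratedFDeriv_smul_tfShift_le k n g
  refine ⟨C, fun F hF t => ?_⟩
  rw [← (hasFTaylorSeriesUpTo_integral_mul_tfShift g hF).eq_iteratedFDeriv (mod_cast le_top) t,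
    ← Real.norm_of_nonneg (by positivity : 0 ≤ ‖t‖ ^ k), ← norm_smul, ← integral_smul,
    ← integral_const_mul]
  refine norm_integral_le_of_norm_le ((hF.integrable_pow_mul_norm _).const_mul C)
    (.of_forall fun z => ?_)
  rw [norm_smul, Real.norm_of_nonneg (by positivity)]
  exact hC (F z) z t

/-- The Schwartz function `∫ F(z) π(z) g dz`, the superposition of the time-frequency shifts of `g`
with coefficients `F`. -/
def synthesis (g : 𝓢(Config d, ℂ)) (F : Phase d → ℂ) (hF : HasFiniteMoments F) :
    𝓢(Config d, ℂ) where
  toFun t := ∫ z, F z * tfShift z g t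
  smooth' := (hasFTaylorSeriesUpTo_integral_mul_tfShift g hF).contDiff
  decay' k n := by
    obtain ⟨C, hC⟩ := exists_norm_pow_mul_iteratedFDeriv_integral_mul_tfShift_le k n g
    exact ⟨_, hC F hF⟩

theorem synthesis_apply (g : 𝓢(Config d, ℂ)) (hF : HasFiniteMoments F) (t : Config d) :
    synthesis g F hF t = ∫ z, F z * tfShift z g t := rfl

theorem exists_seminorm_synthesis_le (k n : ℕ) (g : 𝓢(Config d, ℂ)) :
    ∃ C : ℝ, ∀ F (hF : HasFiniteMoments F),
      SchwartzMap.seminorm ℂ k n (synthesis g F hF) ≤ C * ∫ z, (1 + ‖z‖) ^ (k + n) * ‖F z‖ := by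
  obtain ⟨C, hC⟩ := exists_norm_pow_mul_iteratedFDeriv_integral_mul_tfShift_le k n g
  refine ⟨max C 0, fun F hF =>
    seminorm_le_bound ℂ k n _ (by positivity) fun t => (hC F hF t).trans ?_⟩
  gcongr
  exact le_max_left C 0

theorem l2Pairing_synthesis (g ψ : 𝓢(Config d, ℂ)) (hF : HasFiniteMoments F) :
    l2Pairing (synthesis g F hF) ψ = l2Pairing F (stftFun g ψ) := by
  obtain ⟨q, -, hq⟩ :=
    exists_continuous_seminorm_pow_mul_norm_le (𝕜 := ℂ) (E := Config d) (F := ℂ) 0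
  have hint : Integrable (Function.uncurry fun t z => F z * tfShift z g t * conj (ψ t))
      (volume.prod volume) := by
    refine (((ψ.integrable (μ := volume)).norm.mul_prod hF.integrable.norm).const_mul (q g)).mono'
      ((hF.integrable.1.comp_snd.mul ?_).mul ?_) (.of_forall fun p => ?_)
    · exact ((stronglyMeasurable_uncurry_tfShift g.continuous.stronglyMeasurable).comp_measurable
        measurable_swap).aestronglyMeasurable
    · exact Continuous.aestronglyMeasurable (by fun_prop)
    · have hg := hq g (p.1 - pos p.2)
      rw [pow_zero, one_mul] at hg
      rw [Function.uncurry, norm_mul, norm_mul, RCLike.norm_conj, norm_tfShift, mul_right_comm,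
        mul_comm, mul_comm ‖ψ p.1‖]
      gcongr
  have hψ : ∀ z, ∫ t, F z * tfShift z g t * conj (ψ t) = F z * conj (stftFun g ψ z) := fun z => by
    rw [stftFun, conj_l2Pairing, l2Pairing, ← integral_const_mul]
    simp only [mul_assoc]
  simp only [l2Pairing, synthesis_apply, ← integral_mul_const]
  rw [integral_integral_swap hint]
  simp only [hψ]

end Synthesis

section Reconstruction

theorem ae_eq_of_forall_l2Pairing_schwartz_eq {f g : Config d → ℂ} (hf : MemLp f 2)
    (hg : MemLp g 2) (h : ∀ ψ : 𝓢(Config d, ℂ), l2Pairing f ψ = l2Pairing g ψ) :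
    f =ᵐ[volume] g := by
  have hdist : ∀ {f : Config d → ℂ} (hf : MemLp f 2) (ψ : 𝓢(Config d, ℂ)),
      Lp.toTemperedDistribution (hf.toLp f) ψ = l2Pairing f (conjS ψ) := fun hf ψ => by
    rw [Lp.toTemperedDistribution_apply]
    refine integral_congr_ae ?_
    filter_upwards [hf.coeFn_toLp] with t ht
    rw [ht, conjS_apply, Complex.conj_conj, smul_eq_mul, mul_comm]
  have hinj : Function.Injective (Lp.toTemperedDistributionCLM ℂ (volume : Measure (Config d)) 2) :=
    LinearMap.ker_eq_bot.1 Lp.ker_toTemperedDistributionCLM_eq_bot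
  refine (MemLp.toLp_eq_toLp_iff hf hg).1 (hinj ?_)
  ext ψ
  simp only [Lp.toTemperedDistributionCLM_apply, hdist, h]

theorem l2Pairing_self_ne_zero {φ : 𝓢(Config d, ℂ)} (hφ : φ ≠ 0) :
    l2Pairing (φ : Config d → ℂ) φ ≠ 0 := by
  rw [l2Pairing_eq_inner (φ.memLp 2) (φ.memLp 2), inner_self_ne_zero]
  exact fun h => hφ (injective_toLp 2 volume (h.trans (map_zero (toLpCLM ℂ ℂ 2 volume)).symm))

variable {φ : 𝓢(Config d, ℂ)} {f : Config d → ℂ}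

theorem synthesis_stftFun_ae_eq (hf : MemLp f 2) (hF : HasFiniteMoments (stftFun φ f)) :
    synthesis φ (stftFun φ f) hF =ᵐ[volume] l2Pairing (φ : Config d → ℂ) φ • f := by
  refine ae_eq_of_forall_l2Pairing_schwartz_eq ((synthesis φ _ hF).memLp 2)
    (hf.const_smul _) fun ψ => ?_
  rw [l2Pairing_synthesis, l2Pairing_stftFun_stftFun (φ.memLp 2) hf, conj_l2Pairing,
    l2Pairing_smul_left, mul_comm]

theorem synthesis_stftFun (φ f : 𝓢(Config d, ℂ)) :
    synthesis φ (stftFun φ f) (hasFiniteMoments_stftFun φ f) =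
      l2Pairing (φ : Config d → ℂ) φ • f :=
  DFunLike.coe_injective ((Continuous.ae_eq_iff_eq volume (SchwartzMap.continuous _)
    (SchwartzMap.continuous _)).1 (synthesis_stftFun_ae_eq (f.memLp 2) _))

theorem exists_schwartz_ae_eq (hφ : φ ≠ 0) (hf : MemLp f 2)
    (hF : HasFiniteMoments (stftFun φ f)) : ∃ Φ : 𝓢(Config d, ℂ), f =ᵐ[volume] Φ := by
  refine ⟨(l2Pairing (φ : Config d → ℂ) φ)⁻¹ • synthesis φ (stftFun φ f) hF, ?_⟩
  filter_upwards [synthesis_stftFun_ae_eq hf hF] with t ht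
  rw [_root_.smul_apply, ht, Pi.smul_apply, inv_smul_smul₀ (l2Pairing_self_ne_zero hφ)]

theorem exists_seminorm_le_integral_stftFun (hφ : φ ≠ 0) (k n : ℕ) :
    ∃ C : ℝ, ∀ f : 𝓢(Config d, ℂ),
      SchwartzMap.seminorm ℂ k n f ≤ C * ∫ z, (1 + ‖z‖) ^ (k + n) * ‖stftFun φ f z‖ := by
  obtain ⟨C, hC⟩ := exists_seminorm_synthesis_le k n φ
  have hφ0 : 0 < ‖l2Pairing (φ : Config d → ℂ) φ‖ := norm_pos_iff.2 (l2Pairing_self_ne_zero hφ)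
  refine ⟨C / ‖l2Pairing (φ : Config d → ℂ) φ‖, fun f => ?_⟩
  have h := hC _ (hasFiniteMoments_stftFun φ f)
  rwa [synthesis_stftFun, map_smul_eq_mul, ← le_div_iff₀' hφ0, ← div_mul_eq_mul_div] at h

theorem exists_stftFun_ne_zero (hφ : φ ≠ 0) (hf : MemLp f 2) (hf0 : ¬ f =ᵐ[volume] 0) :
    ∃ w, stftFun φ f w ≠ 0 := by
  by_contra! hzero
  refine hf0 (ae_eq_of_forall_l2Pairing_schwartz_eq hf MemLp.zero fun ψ => ?_)
  have hmoyal := l2Pairing_stftFun_stftFun (φ.memLp 2) hf φ ψ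
  have hzero_left : l2Pairing (stftFun φ f) (stftFun φ ψ) = 0 := by simp [l2Pairing, hzero]
  rw [hzero_left, conj_l2Pairing, eq_comm, mul_eq_zero_iff_right (l2Pairing_self_ne_zero hφ)]
    at hmoyal
  rw [hmoyal]
  simp [l2Pairing]

theorem exists_pow_mul_norm_stftFun_tfShift_le (φ ψ : 𝓢(Config d, ℂ)) (N : ℕ) :
    ∃ C : ℝ, ∀ z u,
      (1 + ‖z‖) ^ N * ‖stftFun ψ (tfShift z φ) u‖ ≤ C * (1 + ‖u‖) ^ N := by
  obtain ⟨q, -, hq⟩ := exists_continuous_seminorm_pow_mul_norm_stftFun_le ψ N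
  refine ⟨q φ, fun z u => ?_⟩
  rw [norm_stftFun_tfShift]
  calc (1 + ‖z‖) ^ N * ‖stftFun ψ φ (u - z)‖
      ≤ ((1 + ‖u‖) * (1 + ‖u - z‖)) ^ N * ‖stftFun ψ φ (u - z)‖ := by
        gcongr
        simpa only [norm_sub_rev] using one_add_norm_le_mul_one_add_norm_sub z u
    _ = (1 + ‖u - z‖) ^ N * ‖stftFun ψ φ (u - z)‖ * (1 + ‖u‖) ^ N := by
        rw [mul_pow]
        ring
    _ ≤ q φ * (1 + ‖u‖) ^ N := by
        gcongr
        exact hq φ (u - z)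

-- With `f` and `π(z) φ`, `π(w) φ` inserted, Moyal's identity expresses `V_φ f(z) conj(V_φ f(w))`
-- through the ambiguity function `V_f f`; it remains to fix `w` with `V_φ f(w) ≠ 0`.
theorem hasFiniteMoments_stftFun_of_ambiguity (hf : MemLp f 2) (hf0 : ¬ f =ᵐ[volume] 0)
    (hF : HasFiniteMoments (stftFun f f)) (hφ : φ ≠ 0) : HasFiniteMoments (stftFun φ f) := by
  obtain ⟨w, hw⟩ := exists_stftFun_ne_zero hφ hf hf0
  refine hasFiniteMoments_of_forall_pow_mul_norm_le (stronglyMeasurable_stftFun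
    φ.continuous.aestronglyMeasurable hf.1).aestronglyMeasurable fun N => ?_
  obtain ⟨C, hC⟩ := exists_pow_mul_norm_stftFun_tfShift_le φ (tfShiftS w φ) N
  refine ⟨C * (∫ u, (1 + ‖u‖) ^ N * ‖stftFun f f u‖) / ‖stftFun φ f w‖, fun z => ?_⟩
  have hmoyal : l2Pairing (stftFun f f) (stftFun (tfShiftS w φ) (tfShiftS z φ)) =
      stftFun φ f z * conj (stftFun φ f w) := by
    rw [l2Pairing_stftFun_stftFun hf hf, coe_tfShiftS, coe_tfShiftS, stftFun, stftFun]
  rw [le_div_iff₀ (norm_pos_iff.2 hw), mul_assoc, ← RCLike.norm_conj (stftFun φ f w), ← norm_mul,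
    ← hmoyal, ← Real.norm_of_nonneg (by positivity : 0 ≤ (1 + ‖z‖) ^ N), ← norm_smul, l2Pairing,
    ← integral_smul, ← integral_const_mul]
  refine norm_integral_le_of_norm_le ((hF.integrable_pow_mul_norm N).const_mul C)
    (.of_forall fun u => ?_)
  rw [norm_smul, norm_mul, RCLike.norm_conj, Real.norm_of_nonneg (by positivity), mul_left_comm,
    coe_tfShiftS z]
  calc ‖stftFun f f u‖ * ((1 + ‖z‖) ^ N * ‖stftFun (tfShiftS w φ) (tfShift z φ) u‖)
      ≤ ‖stftFun f f u‖ * (C * (1 + ‖u‖) ^ N) := by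
        exact mul_le_mul_of_nonneg_left (hC z u) (norm_nonneg _)
    _ = C * ((1 + ‖u‖) ^ N * ‖stftFun f f u‖) := by ring

end Reconstruction

section Intertwiners

theorem coeFn_tfShiftL2 (z : Phase d) (f : L2 d) : tfShiftL2 z f =ᵐ[volume] tfShift z f :=
  (memLp_tfShift z (Lp.memLp f)).coeFn_toLp

theorem tfShiftL2_toLp (z : Phase d) (φ : 𝓢(Config d, ℂ)) :
    tfShiftL2 z (φ.toLp 2 volume) = (tfShiftS z φ).toLp 2 volume := by
  refine Lp.ext <| (coeFn_tfShiftL2 z _).trans <|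
    (tfShift_ae_congr z (φ.coeFn_toLp 2 volume)).trans ?_
  rw [← coe_tfShiftS]
  exact ((tfShiftS z φ).coeFn_toLp 2 volume).symm

theorem stftFun_eq_inner (g f : L2 d) (z : Phase d) :
    stftFun g f z = inner ℂ (tfShiftL2 z g) f := by
  rw [stftFun, l2Pairing_eq_inner (Lp.memLp f) (memLp_tfShift z (Lp.memLp g)), Lp.toLp_coeFn,
    tfShiftL2]

theorem stftFun_toLp (g f : 𝓢(Config d, ℂ)) :
    stftFun (g.toLp 2 volume : L2 d) (f.toLp 2 volume : L2 d) = stftFun g f :=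
  stftFun_congr_ae (g.coeFn_toLp 2 volume) (f.coeFn_toLp 2 volume)

/-- The unitary operator `W` on `L²` intertwines time-frequency shifts along the map `B` of phase
space, up to phase factors. -/
def Intertwines (W : L2 d ≃ₗᵢ[ℂ] L2 d) (B : Phase d → Phase d) : Prop :=
  ∀ z, ∃ c : ℂ, ‖c‖ = 1 ∧ ∀ f, W (tfShiftL2 z f) = c • tfShiftL2 (B z) (W f)

variable {W : L2 d ≃ₗᵢ[ℂ] L2 d} {B : Phase d ≃L[ℝ] Phase d}

theorem Intertwines.norm_stftFun {B : Phase d → Phase d} (h : Intertwines W B) (g f : L2 d)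
    (z : Phase d) : ‖stftFun (W g) (W f) (B z)‖ = ‖stftFun g f z‖ := by
  obtain ⟨c, hc, hW⟩ := h z
  rw [stftFun_eq_inner, stftFun_eq_inner, ← W.inner_map_map (tfShiftL2 z g) f, hW,
    inner_smul_left, norm_mul, RCLike.norm_conj, hc, one_mul]

theorem Intertwines.exists_continuous_seminorm_pow_mul_norm_stftFun_le (h : Intertwines W B)
    (φ : 𝓢(Config d, ℂ)) (N : ℕ) :
    ∃ (C : ℝ) (q : Seminorm ℂ 𝓢(Config d, ℂ)), Continuous q ∧ ∀ (f : 𝓢(Config d, ℂ)) z,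
      (1 + ‖z‖) ^ N * ‖stftFun (W (φ.toLp 2 volume)) (W (f.toLp 2 volume)) z‖ ≤ C * q f := by
  obtain ⟨q, hq, hqf⟩ := TimeFreq.exists_continuous_seminorm_pow_mul_norm_stftFun_le φ N
  refine ⟨(1 + ‖(B : Phase d →L[ℝ] Phase d)‖) ^ N, q, hq, fun f z => ?_⟩
  obtain ⟨u, rfl⟩ := B.surjective z
  rw [h.norm_stftFun, stftFun_toLp]
  calc (1 + ‖B u‖) ^ N * ‖stftFun φ f u‖
      ≤ ((1 + ‖(B : Phase d →L[ℝ] Phase d)‖) * (1 + ‖u‖)) ^ N * ‖stftFun φ f u‖ := by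
        gcongr
        exact one_add_norm_map_le (B : Phase d →L[ℝ] Phase d) u
    _ = (1 + ‖(B : Phase d →L[ℝ] Phase d)‖) ^ N * ((1 + ‖u‖) ^ N * ‖stftFun φ f u‖) := by
        rw [mul_pow, mul_assoc]
    _ ≤ (1 + ‖(B : Phase d →L[ℝ] Phase d)‖) ^ N * q f := by
        gcongr
        exact hqf f u

theorem Intertwines.hasFiniteMoments_stftFun (h : Intertwines W B) (f : 𝓢(Config d, ℂ)) :
    HasFiniteMoments (stftFun (W (f.toLp 2 volume)) (W (f.toLp 2 volume))) :=
  hasFiniteMoments_of_forall_pow_mul_norm_le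
    (stronglyMeasurable_stftFun (Lp.memLp _).1 (Lp.memLp _).1).aestronglyMeasurable fun N => by
      obtain ⟨C, q, -, hq⟩ := h.exists_continuous_seminorm_pow_mul_norm_stftFun_le f N
      exact ⟨C * q f, hq f⟩

theorem Intertwines.exists_toLp_eq (h : Intertwines W B) (f : 𝓢(Config d, ℂ)) :
    ∃ Φ : 𝓢(Config d, ℂ), Φ.toLp 2 volume = W (f.toLp 2 volume) := by
  rcases eq_or_ne f 0 with rfl | hf
  · exact ⟨0, ((map_zero (W.toLinearMap ∘ₗ (toLpCLM ℂ ℂ 2 volume).toLinearMap)).trans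
      (map_zero (toLpCLM ℂ ℂ 2 volume)).symm).symm⟩
  have hWf : ¬ W (f.toLp 2 volume) =ᵐ[volume] (0 : Config d → ℂ) := fun hzero => by
    have hf0 : f.toLp 2 volume = 0 := W.map_eq_zero_iff.1 (Lp.eq_zero_iff_ae_eq_zero.2 hzero)
    exact hf (injective_toLp 2 volume (hf0.trans (map_zero (toLpCLM ℂ ℂ 2 volume)).symm))
  obtain ⟨Φ, hΦ⟩ := exists_schwartz_ae_eq hf (Lp.memLp _) (hasFiniteMoments_stftFun_of_ambiguity
    (Lp.memLp _) hWf (h.hasFiniteMoments_stftFun f) hf)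
  exact ⟨Φ, Lp.ext ((Φ.coeFn_toLp 2 volume).trans hΦ.symm)⟩

/-- The restriction to the Schwartz space of a unitary operator intertwining time-frequency
shifts along a linear map. -/
def Intertwines.schwartzLM (h : Intertwines W B) : 𝓢(Config d, ℂ) →ₗ[ℂ] 𝓢(Config d, ℂ) :=
  LinearMap.codRestrictOfInjective
    (W.toLinearMap ∘ₗ (toLpCLM ℂ ℂ 2 (volume : Measure (Config d))).toLinearMap)
    (toLpCLM ℂ ℂ 2 volume).toLinearMap (injective_toLp 2 volume) h.exists_toLp_eq

theorem Intertwines.toLp_schwartzLM (h : Intertwines W B) (f : 𝓢(Config d, ℂ)) :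
    (h.schwartzLM f).toLp 2 volume = W (f.toLp 2 volume) :=
  LinearMap.codRestrictOfInjective_comp_apply _ (toLpCLM ℂ ℂ 2 volume).toLinearMap _
    h.exists_toLp_eq f

theorem Intertwines.injective_schwartzLM (h : Intertwines W B) :
    Function.Injective h.schwartzLM := fun f₁ f₂ hf =>
  injective_toLp 2 volume (W.injective (by
    rw [← h.toLp_schwartzLM, hf, h.toLp_schwartzLM]))

theorem Intertwines.continuous_schwartzLM (h : Intertwines W B) : Continuous h.schwartzLM := by
  by_cases htriv : ∀ f : 𝓢(Config d, ℂ), f = 0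
  · exact continuous_const.congr fun f => (htriv (h.schwartzLM f)).symm
  push Not at htriv
  obtain ⟨φ, hφ⟩ := htriv
  have hWφ : h.schwartzLM φ ≠ 0 := fun h0 =>
    hφ (h.injective_schwartzLM (h0.trans (map_zero h.schwartzLM).symm))
  refine continuous_of_forall_schwartz_seminorm_le _ fun k n => ?_
  set r := (volume : Measure (Phase d)).integrablePower
  obtain ⟨C, hC⟩ := exists_seminorm_le_integral_stftFun hWφ k n
  obtain ⟨D, q, hq, hDq⟩ := h.exists_continuous_seminorm_pow_mul_norm_stftFun_le φ (k + n + r)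
  refine ⟨|C| * D * ∫ z : Phase d, (1 + ‖z‖) ^ (-(r : ℝ)), q, hq, fun f => ?_⟩
  have hmoment : ∫ z, (1 + ‖z‖) ^ (k + n) * ‖stftFun (h.schwartzLM φ) (h.schwartzLM f) z‖ ≤
      D * q f * ∫ z : Phase d, (1 + ‖z‖) ^ (-(r : ℝ)) :=
    integral_pow_mul_norm_le fun z => by
      rw [← stftFun_toLp, h.toLp_schwartzLM, h.toLp_schwartzLM]
      exact hDq f z
  calc SchwartzMap.seminorm ℂ k n (h.schwartzLM f)
      ≤ |C| * ∫ z, (1 + ‖z‖) ^ (k + n) * ‖stftFun (h.schwartzLM φ) (h.schwartzLM f) z‖ :=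
        (hC _).trans (by gcongr; exact le_abs_self C)
    _ ≤ |C| * (D * q f * ∫ z : Phase d, (1 + ‖z‖) ^ (-(r : ℝ))) := by gcongr
    _ = |C| * D * (∫ z : Phase d, (1 + ‖z‖) ^ (-(r : ℝ))) * q f := by ring

/-- The restriction `Intertwines.schwartzLM` as a continuous operator. -/
def Intertwines.schwartzCLM (h : Intertwines W B) : 𝓢(Config d, ℂ) →L[ℂ] 𝓢(Config d, ℂ) :=
  ⟨h.schwartzLM, h.continuous_schwartzLM⟩

theorem Intertwines.toLp_schwartzCLM (h : Intertwines W B) (f : 𝓢(Config d, ℂ)) :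
    (h.schwartzCLM f).toLp 2 volume = W (f.toLp 2 volume) :=
  h.toLp_schwartzLM f

end Intertwiners

section Representation

theorem exists_inner_representation {𝕜 E H : Type*} [RCLike 𝕜] [AddCommGroup E] [Module 𝕜 E]
    [NormedAddCommGroup H] [InnerProductSpace 𝕜 H] [CompleteSpace H] (J : E →ₗ[𝕜] H)
    (ℓ : E →ₗ[𝕜] 𝕜) {C : ℝ} (h : ∀ x, ‖ℓ x‖ ≤ C * ‖J x‖) :
    ∃ y : H, ∀ x, ℓ x = inner 𝕜 y (J x) := by
  have hℓ : ∀ x, ℓ.compLeftInverse J ⟨J x, x, rfl⟩ = ℓ x := fun x =>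
    LinearMap.compLeftInverse_apply_of_bdd _ _ ⟨C, h⟩ x (J x) rfl
  obtain ⟨G, hG, -⟩ := exists_extension_norm_eq J.range
    ((ℓ.compLeftInverse J).mkContinuous C (by
      rintro ⟨-, x, rfl⟩
      exact (congrArg norm (hℓ x)).trans_le (h x)))
  refine ⟨(InnerProductSpace.toDual 𝕜 H).symm G, fun x => ?_⟩
  rw [InnerProductSpace.toDual_symm_apply, ← hℓ]
  exact (hG ⟨J x, x, rfl⟩).symm

theorem integral_norm_mul_norm_le {α E F : Type*} [MeasurableSpace α] {μ : Measure α}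
    [NormedAddCommGroup E] [NormedAddCommGroup F] {f : α → E} {g : α → F} (hf : MemLp f 2 μ)
    (hg : MemLp g 2 μ) :
    ∫ a, ‖f a‖ * ‖g a‖ ∂μ ≤ (eLpNorm f 2 μ).toReal * (eLpNorm g 2 μ).toReal := by
  have h := real_inner_le_norm (hg.norm.toLp _) (hf.norm.toLp _)
  rw [L2.inner_def, Lp.norm_toLp, Lp.norm_toLp, eLpNorm_norm, eLpNorm_norm, mul_comm] at h
  refine le_of_eq_of_le (integral_congr_ae ?_) h
  filter_upwards [hf.norm.coeFn_toLp, hg.norm.coeFn_toLp] with a hfa hga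
  rw [hfa, hga]
  rfl

theorem memLp_pow_smul_stftFun (φ ψ : 𝓢(Config d, ℂ)) (N : ℕ) :
    MemLp (fun z => (1 + ‖z‖) ^ N • stftFun φ ψ z) 2 := by
  set r := (volume : Measure (Phase d)).integrablePower
  obtain ⟨q, -, hq⟩ := exists_continuous_seminorm_pow_mul_norm_stftFun_le φ (N + r)
  refine (memLp_two_inv_one_add_norm_pow (μ := volume)).of_le_mul (c := q ψ)
    (hasFiniteMoments_stftFun φ ψ N).1 (.of_forall fun z => ?_)
  rw [norm_smul, Real.norm_of_nonneg (by positivity), Real.norm_of_nonneg (by positivity),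
    ← div_eq_mul_inv, le_div_iff₀ (by positivity)]
  refine le_of_eq_of_le ?_ (hq ψ z)
  rw [pow_add]
  ring

theorem stftFun_add_right (φ : 𝓢(Config d, ℂ)) (ψ₁ ψ₂ : 𝓢(Config d, ℂ)) :
    stftFun φ (ψ₁ + ψ₂ : 𝓢(Config d, ℂ)) = stftFun φ ψ₁ + stftFun φ ψ₂ := by
  funext z
  simp only [stftFun, l2Pairing, Pi.add_apply, _root_.add_apply, add_mul]
  exact integral_add (integrable_mul_conj (ψ₁.memLp 2) (memLp_tfShift z (φ.memLp 2)))
    (integrable_mul_conj (ψ₂.memLp 2) (memLp_tfShift z (φ.memLp 2)))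

/-- The short-time Fourier transform on the Schwartz space as an operator into a polynomially
weighted `L²` space, the weight being moved into the function. -/
def weightedStft (φ : 𝓢(Config d, ℂ)) (N : ℕ) :
    𝓢(Config d, ℂ) →ₗ[ℂ] Lp ℂ 2 (volume : Measure (Phase d)) where
  toFun ψ := (memLp_pow_smul_stftFun φ ψ N).toLp _
  map_add' ψ₁ ψ₂ := by
    rw [← MemLp.toLp_add]
    congr 1
    funext z
    rw [stftFun_add_right, Pi.add_apply, Pi.add_apply, smul_add]
  map_smul' c ψ := by
    rw [RingHom.id_apply, ← MemLp.toLp_const_smul]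
    congr 1
    funext z
    rw [Pi.smul_apply, smul_comm c]
    congr 1
    exact l2Pairing_smul_left c ψ _

theorem norm_weightedStft (φ ψ : 𝓢(Config d, ℂ)) (N : ℕ) :
    ‖weightedStft φ N ψ‖ = (eLpNorm (fun z => (1 + ‖z‖) ^ N • stftFun φ ψ z) 2).toReal :=
  Lp.norm_toLp _ (memLp_pow_smul_stftFun φ ψ N)

theorem coeFn_weightedStft (φ ψ : 𝓢(Config d, ℂ)) (N : ℕ) :
    weightedStft φ N ψ =ᵐ[volume] fun z => (1 + ‖z‖) ^ N • stftFun φ ψ z :=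
  (memLp_pow_smul_stftFun φ ψ N).coeFn_toLp

theorem exists_norm_le_integral_stftFun {φ : 𝓢(Config d, ℂ)} (hφ : φ ≠ 0)
    (ℓ : 𝓢(Config d, ℂ) →L[ℂ] ℂ) :
    ∃ (C : ℝ) (N : ℕ), ∀ ψ, ‖ℓ ψ‖ ≤ C * ∫ z, (1 + ‖z‖) ^ N * ‖stftFun φ ψ z‖ := by
  refine exists_seminorm_le_of_forall_schwartz_seminorm_le (a := fun ψ => ψ)
    (q := (normSeminorm ℂ ℂ).comp ℓ.toLinearMap)
    (B := fun N ψ => ∫ z, (1 + ‖z‖) ^ N * ‖stftFun φ ψ z‖) (fun N M hNM ψ => ?_)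
    (fun N ψ => integral_nonneg fun z => by positivity)
    (exists_seminorm_le_integral_stftFun hφ) (continuous_norm.comp ℓ.continuous)
  refine integral_mono ((hasFiniteMoments_stftFun φ ψ).integrable_pow_mul_norm N)
    ((hasFiniteMoments_stftFun φ ψ).integrable_pow_mul_norm M) fun z => ?_
  dsimp only
  gcongr
  linarith [norm_nonneg z]

theorem exists_norm_le_norm_weightedStft {φ : 𝓢(Config d, ℂ)} (hφ : φ ≠ 0)
    (ℓ : 𝓢(Config d, ℂ) →L[ℂ] ℂ) :
    ∃ (C : ℝ) (N : ℕ), ∀ ψ, ‖ℓ ψ‖ ≤ C * ‖weightedStft φ N ψ‖ := by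
  set r := (volume : Measure (Phase d)).integrablePower
  obtain ⟨C, N, hC⟩ := exists_norm_le_integral_stftFun hφ ℓ
  refine ⟨|C| * (eLpNorm (fun z : Phase d => ((1 + ‖z‖) ^ r)⁻¹) 2).toReal, N + r, fun ψ => ?_⟩
  calc ‖ℓ ψ‖ ≤ |C| * ∫ z, (1 + ‖z‖) ^ N * ‖stftFun φ ψ z‖ :=
        (hC ψ).trans (by gcongr; exact le_abs_self C)
    _ = |C| * ∫ z, ‖((1 + ‖z‖) ^ r)⁻¹‖ * ‖(1 + ‖z‖) ^ (N + r) • stftFun φ ψ z‖ := by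
        congr 2 with z
        rw [norm_smul, Real.norm_of_nonneg (by positivity), Real.norm_of_nonneg (by positivity),
          pow_add]
        field_simp
    _ ≤ _ := by
        rw [mul_assoc, norm_weightedStft]
        gcongr
        exact integral_norm_mul_norm_le memLp_two_inv_one_add_norm_pow
          (memLp_pow_smul_stftFun φ ψ (N + r))

theorem exists_eq_l2Pairing_stftFun {φ : 𝓢(Config d, ℂ)} (hφ : φ ≠ 0)
    (ℓ : 𝓢(Config d, ℂ) →L[ℂ] ℂ) :
    ∃ (κ : Phase d → ℂ) (N : ℕ), StronglyMeasurable κ ∧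
      Integrable (fun z => ((1 + ‖z‖) ^ N)⁻¹ * ‖κ z‖) ∧ ∀ ψ, ℓ ψ = l2Pairing (stftFun φ ψ) κ := by
  obtain ⟨C, N, hC⟩ := exists_norm_le_norm_weightedStft hφ ℓ
  obtain ⟨y, hy⟩ := exists_inner_representation (weightedStft φ N) ℓ.toLinearMap hC
  have hweight : Continuous fun z : Phase d => (1 + ‖z‖) ^ N := by fun_prop
  refine ⟨fun z => (1 + ‖z‖) ^ N • y z, N + (volume : Measure (Phase d)).integrablePower,
    hweight.stronglyMeasurable.smul (Lp.stronglyMeasurable y), ?_, fun ψ => ?_⟩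
  · refine (memLp_two_inv_one_add_norm_pow.integrable_mul (Lp.memLp y).norm).congr
      (.of_forall fun z => ?_)
    simp only [Pi.mul_apply, norm_smul, norm_pow, pow_add]
    rw [Real.norm_of_nonneg (by positivity)]
    field_simp
  · refine (hy ψ).trans ?_
    rw [L2.inner_def]
    refine integral_congr_ae ?_
    filter_upwards [coeFn_weightedStft φ ψ N] with z hz
    rw [hz, RCLike.inner_apply, Complex.real_smul, Complex.real_smul, map_mul, Complex.conj_ofReal]
    ring

end Representation

section DistributionalStft

theorem conjS_conjS (g : 𝓢(Config d, ℂ)) : conjS (conjS g) = g := by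
  ext t
  rw [conjS_apply, conjS_apply, Complex.conj_conj]

/-- Complex conjugation `conjS` as a continuous antilinear operator. -/
def conjSL (d : ℕ) : 𝓢(Config d, ℂ) →L⋆[ℂ] 𝓢(Config d, ℂ) where
  toFun := conjS
  map_add' φ ψ := map_add (postcompCLM (𝕜 := ℝ) (Complex.conjCLE : ℂ →L[ℝ] ℂ)) φ ψ
  map_smul' c φ := by
    ext t
    exact map_mul conj c (φ t)
  cont := (postcompCLM (𝕜 := ℝ) (Complex.conjCLE : ℂ →L[ℝ] ℂ)).continuous

theorem bracket_smul_right (f : 𝓢'(Config d, ℂ)) (c : ℂ) (ψ : 𝓢(Config d, ℂ)) :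
    bracket f (c • ψ) = conj c * bracket f ψ :=
  (congrArg f (map_smulₛₗ (conjSL d) c ψ)).trans (map_smul f (conj c) (conjS ψ))

theorem exists_bracket_eq_l2Pairing_stftFun {φ : 𝓢(Config d, ℂ)} (hφ : φ ≠ 0)
    (f : 𝓢'(Config d, ℂ)) :
    ∃ (κ : Phase d → ℂ) (N : ℕ), StronglyMeasurable κ ∧
      Integrable (fun u => ((1 + ‖u‖) ^ N)⁻¹ * ‖κ u‖) ∧
      ∀ ψ, bracket f ψ = l2Pairing κ (stftFun φ ψ) := by
  obtain ⟨κ, N, hκm, hκ, h⟩ := exists_eq_l2Pairing_stftFun hφ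
    ((starL ℂ (A := ℂ)).toContinuousLinearMap.comp
      ((f : 𝓢(Config d, ℂ) →L[ℂ] ℂ).comp (conjSL d)))
  refine ⟨κ, N, hκm, hκ, fun ψ => ?_⟩
  rw [← conj_l2Pairing, ← h ψ]
  exact (Complex.conj_conj _).symm

theorem stronglyMeasurable_uncurry_stftFun_tfShift {g φ : Config d → ℂ}
    (hg : AEStronglyMeasurable g) (hφ : AEStronglyMeasurable φ) :
    StronglyMeasurable (Function.uncurry fun u z => stftFun g (tfShift u φ) z) := by
  have hmod : Continuous fun p : Phase d × Phase d => modFactor (p.2 - p.1) (pos p.1) :=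
    (contDiff_uncurry_modFactor (n := 0)).continuous.comp
      (f := fun p : Phase d × Phase d => (p.2 - p.1, pos p.1))
      ((continuous_snd.sub continuous_fst).prodMk (continuous_pos.comp continuous_fst))
  simp only [stftFun_tfShift]
  exact hmod.stronglyMeasurable.star.mul
    ((stronglyMeasurable_stftFun hg hφ).comp_measurable
      (g := fun p : Phase d × Phase d => p.2 - p.1) (measurable_snd.sub measurable_fst))

variable {φ : 𝓢(Config d, ℂ)} {f : 𝓢'(Config d, ℂ)} {κ : Phase d → ℂ}

theorem stft_eq_integral (h : ∀ ψ, bracket f ψ = l2Pairing κ (stftFun φ ψ))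
    (g : 𝓢(Config d, ℂ)) (z : Phase d) :
    stft g f z = ∫ u, κ u * stftFun g (tfShift u φ) z := by
  simp only [stft, h, l2Pairing.eq_1 κ, stftFun, conj_l2Pairing, coe_tfShiftS]

theorem stronglyMeasurable_stft {g : 𝓢(Config d, ℂ)} (hg : g ≠ 0) (f : 𝓢'(Config d, ℂ)) :
    StronglyMeasurable (stft g f) := by
  obtain ⟨κ, N, hκm, -, hκ⟩ := exists_bracket_eq_l2Pairing_stftFun hg f
  rw [funext (stft_eq_integral hκ g)]
  exact StronglyMeasurable.integral_prod_left
    (f := fun u z => κ u * stftFun g (tfShift u g) z)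
    ((hκm.comp_measurable measurable_fst).mul (stronglyMeasurable_uncurry_stftFun_tfShift
      g.continuous.aestronglyMeasurable g.continuous.aestronglyMeasurable))

theorem integrable_mul_stftFun_tfShift_mul_conj (hκm : StronglyMeasurable κ) {N : ℕ}
    (hκ : Integrable fun u => ((1 + ‖u‖) ^ N)⁻¹ * ‖κ u‖) (g φ : 𝓢(Config d, ℂ)) {F : Phase d → ℂ}
    (hF : HasFiniteMoments F) :
    Integrable (Function.uncurry fun z u => κ u * stftFun g (tfShift u φ) z * conj (F z))
      (volume.prod volume) := by
  obtain ⟨C, hC⟩ := exists_pow_mul_norm_stftFun_tfShift_le φ g N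
  refine (((hF.integrable_pow_mul_norm N).mul_prod hκ).const_mul C).mono'
    (((hκm.comp_measurable measurable_snd).mul ((stronglyMeasurable_uncurry_stftFun_tfShift
      g.continuous.aestronglyMeasurable φ.continuous.aestronglyMeasurable).comp_measurable
        measurable_swap)).aestronglyMeasurable.mul hF.integrable.1.comp_fst.star)
    (.of_forall fun ⟨z, u⟩ => ?_)
  have hV : ‖stftFun g (tfShift u φ) z‖ ≤ C * (1 + ‖z‖) ^ N * ((1 + ‖u‖) ^ N)⁻¹ := by
    rw [← div_eq_mul_inv, le_div_iff₀' (by positivity)]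
    exact hC u z
  simp only [Function.uncurry, norm_mul, RCLike.norm_conj]
  calc ‖κ u‖ * ‖stftFun g (tfShift u φ) z‖ * ‖F z‖
      ≤ ‖κ u‖ * (C * (1 + ‖z‖) ^ N * ((1 + ‖u‖) ^ N)⁻¹) * ‖F z‖ := by gcongr
    _ = C * ((1 + ‖z‖) ^ N * ‖F z‖ * (((1 + ‖u‖) ^ N)⁻¹ * ‖κ u‖)) := by ring

theorem l2Pairing_stft {g : 𝓢(Config d, ℂ)} (hg : g ≠ 0) (f : 𝓢'(Config d, ℂ))
    {F : Phase d → ℂ} (hF : HasFiniteMoments F) :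
    l2Pairing (stft g f) F = bracket f (synthesis g F hF) := by
  obtain ⟨κ, N, hκm, hκint, hκ⟩ := exists_bracket_eq_l2Pairing_stftFun hg f
  have hV : ∀ u, conj (stftFun g (synthesis g F hF) u) =
      ∫ z, stftFun g (tfShift u g) z * conj (F z) := fun u => by
    rw [stftFun, ← coe_tfShiftS, l2Pairing_synthesis, conj_l2Pairing, l2Pairing]
  calc l2Pairing (stft g f) F
      = ∫ z, ∫ u, κ u * stftFun g (tfShift u g) z * conj (F z) := by
        simp only [l2Pairing, stft_eq_integral hκ, integral_mul_const]
    _ = ∫ u, ∫ z, κ u * stftFun g (tfShift u g) z * conj (F z) :=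
        integral_integral_swap (integrable_mul_stftFun_tfShift_mul_conj hκm hκint g g hF)
    _ = bracket f (synthesis g F hF) := by
        simp only [hκ, l2Pairing, hV, mul_assoc, integral_const_mul]

theorem l2Pairing_stft_stftFun {g : 𝓢(Config d, ℂ)} (hg : g ≠ 0) (f : 𝓢'(Config d, ℂ))
    (ψ : 𝓢(Config d, ℂ)) :
    l2Pairing (stft g f) (stftFun g ψ) = conj (l2Pairing (g : Config d → ℂ) g) * bracket f ψ := by
  rw [l2Pairing_stft hg f (hasFiniteMoments_stftFun g ψ), synthesis_stftFun, bracket_smul_right]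

theorem enorm_l2Pairing_mul_enorm_stft_le {g : 𝓢(Config d, ℂ)} (hg : g ≠ 0) (h : 𝓢(Config d, ℂ))
    (f : 𝓢'(Config d, ℂ)) (w : Phase d) :
    ‖l2Pairing (g : Config d → ℂ) g‖ₑ * ‖stft h f w‖ₑ ≤
      ∫⁻ z, ‖stft g f z‖ₑ * ‖stftFun g h (z - w)‖ₑ := by
  calc ‖l2Pairing (g : Config d → ℂ) g‖ₑ * ‖stft h f w‖ₑ
      = ‖l2Pairing (stft g f) (stftFun g (tfShiftS w h))‖ₑ := by
        rw [l2Pairing_stft_stftFun hg, enorm_mul, RCLike.enorm_conj, stft]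
    _ ≤ ∫⁻ z, ‖stft g f z * conj (stftFun g (tfShiftS w h) z)‖ₑ :=
        enorm_integral_le_lintegral_enorm _
    _ = ∫⁻ z, ‖stft g f z‖ₑ * ‖stftFun g h (z - w)‖ₑ := by
        refine lintegral_congr fun z => ?_
        rw [enorm_mul, RCLike.enorm_conj, coe_tfShiftS, ← ofReal_norm (stftFun _ _ z),
          norm_stftFun_tfShift, ofReal_norm]

end DistributionalStft

section TemperedExtension

/-- The operator on `𝓢'` adjoint to the operator `P` on `𝓢` with respect to the sesquilinear
`bracket`, see `bracket_bracketAdjoint`. -/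
def bracketAdjoint (P : 𝓢(Config d, ℂ) →L[ℂ] 𝓢(Config d, ℂ)) :
    𝓢'(Config d, ℂ) →L[ℂ] 𝓢'(Config d, ℂ) :=
  PointwiseConvergenceCLM.precomp ℂ
    ((conjSL d).comp (P.comp (conjSL d)) : 𝓢(Config d, ℂ) →L[ℂ] 𝓢(Config d, ℂ))

theorem bracket_bracketAdjoint (P : 𝓢(Config d, ℂ) →L[ℂ] 𝓢(Config d, ℂ)) (f : 𝓢'(Config d, ℂ))
    (φ : 𝓢(Config d, ℂ)) : bracket (bracketAdjoint P f) φ = bracket f (P φ) :=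
  congrArg (fun ψ => f (conjS (P ψ))) (conjS_conjS φ)

theorem eq_of_forall_bracket_eq {f f' : 𝓢'(Config d, ℂ)} (h : ∀ φ, bracket f φ = bracket f' φ) :
    f = f' := by
  ext φ
  simpa only [bracket, conjS_conjS] using h (conjS φ)

theorem bracket_toTemperedDistribution (f : L2 d) (φ : 𝓢(Config d, ℂ)) :
    bracket (Lp.toTemperedDistribution f) φ = inner ℂ (φ.toLp 2 volume : L2 d) f := by
  rw [bracket, Lp.toTemperedDistribution_apply, L2.inner_def]
  refine integral_congr_ae ?_
  filter_upwards [φ.coeFn_toLp 2 volume] with t ht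
  rw [ht, RCLike.inner_apply, conjS_apply, smul_eq_mul, mul_comm]

theorem isTemperedExtension_bracketAdjoint {U : L2 d ≃ₗᵢ[ℂ] L2 d}
    {P : 𝓢(Config d, ℂ) →L[ℂ] 𝓢(Config d, ℂ)}
    (hP : ∀ φ : 𝓢(Config d, ℂ), (P φ).toLp 2 volume = U.symm (φ.toLp 2 volume)) :
    IsTemperedExtension U (bracketAdjoint P) := fun f =>
  eq_of_forall_bracket_eq fun φ => by
    rw [bracket_bracketAdjoint, bracket_toTemperedDistribution, bracket_toTemperedDistribution,
      hP, ← U.inner_map_map, U.apply_symm_apply]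

variable {W : L2 d ≃ₗᵢ[ℂ] L2 d} {B : Phase d ≃L[ℝ] Phase d}

theorem Intertwines.schwartzCLM_tfShiftS (h : Intertwines W B) (z : Phase d) :
    ∃ c : ℂ, ‖c‖ = 1 ∧
      ∀ g, h.schwartzCLM (tfShiftS z g) = c • tfShiftS (B z) (h.schwartzCLM g) := by
  obtain ⟨c, hc, hW⟩ := h z
  refine ⟨c, hc, fun g => injective_toLp 2 volume ?_⟩
  calc (h.schwartzCLM (tfShiftS z g)).toLp 2 volume
      = c • (tfShiftS (B z) (h.schwartzCLM g)).toLp 2 volume := by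
        rw [h.toLp_schwartzCLM, ← tfShiftL2_toLp, hW, ← tfShiftL2_toLp, h.toLp_schwartzCLM]
    _ = (c • tfShiftS (B z) (h.schwartzCLM g)).toLp 2 volume :=
        (map_smul (toLpCLM ℂ ℂ 2 volume) c _).symm

theorem Intertwines.norm_stft_bracketAdjoint (h : Intertwines W B) (g : 𝓢(Config d, ℂ))
    (f : 𝓢'(Config d, ℂ)) (z : Phase d) :
    ‖stft g (bracketAdjoint h.schwartzCLM f) z‖ = ‖stft (h.schwartzCLM g) f (B z)‖ := by
  obtain ⟨c, hc, hshift⟩ := h.schwartzCLM_tfShiftS z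
  rw [stft, bracket_bracketAdjoint, hshift, bracket_smul_right, norm_mul, RCLike.norm_conj, hc,
    one_mul, stft]

end TemperedExtension

section Symplectic

theorem det_toEuclideanLin_symplectic (A : Matrix.symplecticGroup (Fin d) ℝ) :
    LinearMap.det (Matrix.toEuclideanLin (A : Matrix (Fin d ⊕ Fin d) (Fin d ⊕ Fin d) ℝ)) = 1 := by
  rw [Matrix.toEuclideanLin, Matrix.toLpLin_eq_toLin, LinearMap.det_toLin,
    SymplecticGroup.det_eq_one A.2]

/-- The action `act` of a symplectic matrix on phase space, as a continuous linear equivalence. -/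
def actEquiv (A : Matrix.symplecticGroup (Fin d) ℝ) : Phase d ≃L[ℝ] Phase d :=
  (LinearMap.equivOfDetNeZero
    (Matrix.toEuclideanLin (A : Matrix (Fin d ⊕ Fin d) (Fin d ⊕ Fin d) ℝ))
    (det_toEuclideanLin_symplectic A ▸ one_ne_zero)).toContinuousLinearEquiv

theorem actEquiv_apply (A : Matrix.symplecticGroup (Fin d) ℝ) (z : Phase d) :
    actEquiv A z = act (A : Matrix _ _ ℝ) z := rfl

theorem measurePreserving_actEquiv (A : Matrix.symplecticGroup (Fin d) ℝ) :
    MeasurePreserving (actEquiv A) := by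
  have hmap := Measure.map_linearMap_addHaar_eq_smul_addHaar (volume : Measure (Phase d))
    (f := Matrix.toEuclideanLin (A : Matrix (Fin d ⊕ Fin d) (Fin d ⊕ Fin d) ℝ))
    (det_toEuclideanLin_symplectic A ▸ one_ne_zero)
  rw [det_toEuclideanLin_symplectic, inv_one, abs_one, ENNReal.ofReal_one, one_smul] at hmap
  exact ⟨(actEquiv A).continuous.measurable, hmap⟩

theorem IsMetaplectic.intertwines_symm {A : Matrix.symplecticGroup (Fin d) ℝ}
    {U : L2 d ≃ₗᵢ[ℂ] L2 d} (hU : IsMetaplectic A U) : Intertwines U.symm (actEquiv A).symm := by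
  intro z
  obtain ⟨c, hc, h⟩ := hU ((actEquiv A).symm z)
  refine ⟨c, hc, fun f => ?_⟩
  rw [← actEquiv_apply, ContinuousLinearEquiv.apply_symm_apply] at h
  rw [h, map_smul, U.symm_apply_apply]

end Symplectic

section ModulationSpaces

theorem polyWeight_le_pow {s : ℝ} (hs : 0 ≤ s) (z : Phase d) :
    polyWeight s z ≤ (1 + ‖z‖) ^ ⌈s⌉₊ := by
  calc polyWeight s z ≤ ((1 + ‖z‖) ^ 2) ^ (s / 2) := by
        unfold polyWeight
        gcongr
        nlinarith [norm_nonneg z]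
    _ = (1 + ‖z‖) ^ s := by
        rw [← Real.rpow_natCast, ← Real.rpow_mul (by positivity), Nat.cast_ofNat,
          mul_div_cancel₀ s two_ne_zero]
    _ ≤ (1 + ‖z‖) ^ (⌈s⌉₊ : ℝ) := by
        gcongr
        · exact le_add_of_nonneg_right (norm_nonneg z)
        · exact Nat.le_ceil s
    _ = (1 + ‖z‖) ^ ⌈s⌉₊ := Real.rpow_natCast _ _

variable {s K : ℝ} {m : Phase d → ℝ}

theorem IsModerate.const_nonneg (hm : IsModerate s K m) : 0 ≤ K := by
  have h := (hm.pos (0 + 0)).trans_le (hm.moderate 0 0)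
  have hv : 0 ≤ polyWeight s (0 : Phase d) := by unfold polyWeight; positivity
  exact (pos_of_mul_pos_left (pos_of_mul_pos_left h (hm.pos 0).le) hv).le

theorem IsModerate.le_mul_of_linear (hm : IsModerate s K m) (hs : 0 ≤ s)
    (L : Phase d →L[ℝ] Phase d) (w z : Phase d) :
    m (L w) ≤ K * (1 + ‖L‖) ^ ⌈s⌉₊ * (1 + ‖w - z‖) ^ ⌈s⌉₊ * m (L z) := by
  have hK := hm.const_nonneg
  have hpos := (hm.pos (L z)).le
  calc m (L w) = m (L (w - z) + L z) := by rw [← map_add, sub_add_cancel]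
    _ ≤ K * polyWeight s (L (w - z)) * m (L z) := hm.moderate _ _
    _ ≤ K * ((1 + ‖L‖) * (1 + ‖w - z‖)) ^ ⌈s⌉₊ * m (L z) := by
        gcongr
        refine (polyWeight_le_pow hs _).trans ?_
        gcongr
        exact one_add_norm_map_le L (w - z)
    _ = K * (1 + ‖L‖) ^ ⌈s⌉₊ * (1 + ‖w - z‖) ^ ⌈s⌉₊ * m (L z) := by rw [mul_pow, ← mul_assoc K]

/-- The kernel dominating the passage from the window `g` to the window `h` in the weighted
modulation norms: `l2Pairing g g * stft h f` is an average of `stft g f` against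
`stftFun g h (z - w)`, and moving a weight of moderate growth inside costs a factor
`D * (1 + ‖w - z‖) ^ n`. -/
def windowKernel (g h : 𝓢(Config d, ℂ)) (D : ℝ) (n : ℕ) (u : Phase d) : ℝ≥0∞ :=
  ENNReal.ofReal (D * ((1 + ‖u‖) ^ n * ‖stftFun g h u‖))

theorem measurable_windowKernel (g h : 𝓢(Config d, ℂ)) (D : ℝ) (n : ℕ) :
    Measurable (windowKernel g h D n) := by
  have hV := (stronglyMeasurable_stftFun g.continuous.aestronglyMeasurable
    h.continuous.aestronglyMeasurable).measurable.norm
  unfold windowKernel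
  fun_prop

theorem lintegral_windowKernel_ne_top (g h : 𝓢(Config d, ℂ)) (D : ℝ) (n : ℕ) :
    ∫⁻ u, windowKernel g h D n u ≠ ⊤ :=
  (((hasFiniteMoments_stftFun g h).integrable_pow_mul_norm n).const_mul D).lintegral_lt_top.ne

theorem enorm_stft_mul_weight_le {g : 𝓢(Config d, ℂ)} (hg : g ≠ 0) (h : 𝓢(Config d, ℂ)) {D : ℝ}
    {n : ℕ} (hpos : ∀ z, 0 ≤ m z) (hm : ∀ w z, m w ≤ D * (1 + ‖w - z‖) ^ n * m z)
    (f : 𝓢'(Config d, ℂ)) (w : Phase d) :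
    ‖l2Pairing (g : Config d → ℂ) g * (stft h f w * m w)‖ₑ ≤
      ∫⁻ z, ‖stft g f z * m z‖ₑ * windowKernel g h D n (z - w) := by
  have hweight : ∀ z, ‖stftFun g h (z - w)‖ₑ * ‖(m w : ℂ)‖ₑ ≤
      ‖(m z : ℂ)‖ₑ * windowKernel g h D n (z - w) := fun z => by
    rw [← enorm_mul, ← ofReal_norm, ← ofReal_norm, windowKernel,
      ← ENNReal.ofReal_mul (norm_nonneg _)]
    refine ENNReal.ofReal_le_ofReal ?_
    rw [norm_mul, Complex.norm_of_nonneg (hpos w), Complex.norm_of_nonneg (hpos z),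
      norm_sub_rev z w]
    calc ‖stftFun g h (z - w)‖ * m w
        ≤ ‖stftFun g h (z - w)‖ * (D * (1 + ‖w - z‖) ^ n * m z) := by gcongr; exact hm w z
      _ = m z * (D * ((1 + ‖w - z‖) ^ n * ‖stftFun g h (z - w)‖)) := by ring
  calc ‖l2Pairing (g : Config d → ℂ) g * (stft h f w * m w)‖ₑ
      ≤ (∫⁻ z, ‖stft g f z‖ₑ * ‖stftFun g h (z - w)‖ₑ) * ‖(m w : ℂ)‖ₑ := by
        rw [enorm_mul, enorm_mul, ← mul_assoc]
        gcongr
        exact enorm_l2Pairing_mul_enorm_stft_le hg h f w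
    _ = ∫⁻ z, ‖stft g f z‖ₑ * (‖stftFun g h (z - w)‖ₑ * ‖(m w : ℂ)‖ₑ) := by
        rw [← lintegral_mul_const' _ _ enorm_ne_top]
        simp only [mul_assoc]
    _ ≤ ∫⁻ z, ‖stft g f z * m z‖ₑ * windowKernel g h D n (z - w) := by
        refine lintegral_mono fun z => ?_
        rw [enorm_mul, mul_assoc]
        exact mul_le_mul_right (hweight z) _

theorem aestronglyMeasurable_stft_mul_weight {g : 𝓢(Config d, ℂ)} (hg : g ≠ 0)
    (f : 𝓢'(Config d, ℂ)) (hm : Measurable m) :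
    AEStronglyMeasurable fun z => stft g f z * (m z : ℂ) :=
  ((stronglyMeasurable_stft hg f).measurable.mul hm.complex_ofReal).aestronglyMeasurable

theorem exists_modNorm_le_mul_modNorm {g : 𝓢(Config d, ℂ)} (hg : g ≠ 0) (h : 𝓢(Config d, ℂ))
    (D : ℝ) (n : ℕ) :
    ∃ C : ℝ≥0, ∀ m : Phase d → ℝ, Measurable m → (∀ z, 0 ≤ m z) →
      (∀ w z, m w ≤ D * (1 + ‖w - z‖) ^ n * m z) → ∀ p : ℝ≥0∞, 1 ≤ p → ∀ f : 𝓢'(Config d, ℂ),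
        modNorm h p m f ≤ C * modNorm g p m f := by
  set a := l2Pairing (g : Config d → ℂ) g
  set I := ∫⁻ u, windowKernel g h D n u
  have ha : ‖a‖ₑ ≠ 0 := enorm_ne_zero.2 (l2Pairing_self_ne_zero hg)
  have hI : I ≠ ⊤ := lintegral_windowKernel_ne_top g h D n
  refine ⟨(‖a‖ₑ⁻¹ * I).toNNReal, fun m hmeas hpos hm p hp f => ?_⟩
  have hschur : ‖a‖ₑ * modNorm h p m f ≤ I * modNorm g p m f := by
    rw [modNorm, ← eLpNorm_const_smul]
    exact eLpNorm_le_of_schur_test (k := fun w z => windowKernel g h D n (z - w))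
      (aestronglyMeasurable_stft_mul_weight hg f hmeas)
      ((measurable_windowKernel g h D n).comp (measurable_snd.sub measurable_fst))
      (fun w => (lintegral_sub_right_eq_self _ w).le) (fun z => (lintegral_sub_left_eq_self _ z).le)
      (enorm_stft_mul_weight_le hg h hpos hm f) hp
  rw [ENNReal.coe_toNNReal (ENNReal.mul_ne_top (ENNReal.inv_ne_top.2 ha) hI), mul_assoc,
    ← ENNReal.inv_mul_cancel_left ha enorm_ne_top (b := modNorm h p m f)]
  gcongr

theorem modNorm_eq_modNorm_comp {g h : 𝓢(Config d, ℂ)} (hg : g ≠ 0) {f f' : 𝓢'(Config d, ℂ)}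
    {B : Phase d → Phase d} (hB : MeasurePreserving B)
    (hf : ∀ z, ‖stft g f' (B z)‖ = ‖stft h f z‖) (hm : Measurable m) (p : ℝ≥0∞) :
    modNorm g p m f' = modNorm h p (fun z => m (B z)) f := by
  rw [modNorm, ← eLpNorm_comp_measurePreserving (aestronglyMeasurable_stft_mul_weight hg f' hm) hB]
  refine eLpNorm_congr_norm_ae (.of_forall fun z => ?_)
  simp only [Function.comp_apply, norm_mul, hf]

theorem mem_modSpace_iff_modNorm_lt_top {g : 𝓢(Config d, ℂ)} (hg : g ≠ 0) (hm : Measurable m)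
    {p : ℝ≥0∞} {f : 𝓢'(Config d, ℂ)} : f ∈ modSpace g p m ↔ modNorm g p m f < ⊤ :=
  and_iff_right (aestronglyMeasurable_stft_mul_weight hg f hm)

end ModulationSpaces

end TimeFreq

end

theorem mainTheorem2 (d : ℕ) (A : Matrix.symplecticGroup (Fin d) ℝ)
    (U : TimeFreq.L2 d ≃ₗᵢ[ℂ] TimeFreq.L2 d) (hU : TimeFreq.IsMetaplectic A U) :
    ∃ T : 𝓢'(TimeFreq.Config d, ℂ) →L[ℂ] 𝓢'(TimeFreq.Config d, ℂ),
      TimeFreq.IsTemperedExtension U T ∧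
      ∀ (g : 𝓢(TimeFreq.Config d, ℂ)), g ≠ 0 →
      ∀ (s : ℝ), 0 ≤ s → ∀ (K : ℝ), ∃ C : ℝ≥0,
      ∀ (m : TimeFreq.Phase d → ℝ), TimeFreq.IsModerate s K m →
      ∀ (p : ℝ≥0∞), 1 ≤ p →
      ∀ f ∈ TimeFreq.modSpace g p (fun z => m (TimeFreq.act A z)),
        T f ∈ TimeFreq.modSpace g p m ∧
        TimeFreq.modNorm g p m (T f) ≤ C * TimeFreq.modNorm g p (fun z => m (TimeFreq.act A z)) f := by
  have hP := hU.intertwines_symm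
  refine ⟨TimeFreq.bracketAdjoint hP.schwartzCLM,
    TimeFreq.isTemperedExtension_bracketAdjoint hP.toLp_schwartzCLM, fun g hg s hs K => ?_⟩
  let L : TimeFreq.Phase d →L[ℝ] TimeFreq.Phase d := TimeFreq.actEquiv A
  obtain ⟨C, hC⟩ := TimeFreq.exists_modNorm_le_mul_modNorm hg (hP.schwartzCLM g)
    (K * (1 + ‖L‖) ^ ⌈s⌉₊) ⌈s⌉₊
  refine ⟨C, fun m hm p hp f hf => ?_⟩
  have htransport := TimeFreq.modNorm_eq_modNorm_comp hg (TimeFreq.measurePreserving_actEquiv A)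
    (h := hP.schwartzCLM g) (f := f) (fun z => by
      rw [hP.norm_stft_bracketAdjoint, ContinuousLinearEquiv.symm_apply_apply]) hm.measurable p
  have hbound := htransport.trans_le (hC (fun z => m (L z)) (hm.measurable.comp L.measurable)
    (fun z => (hm.pos _).le) (hm.le_mul_of_linear hs L) p hp f)
  exact ⟨(TimeFreq.mem_modSpace_iff_modNorm_lt_top hg hm.measurable).2
    (hbound.trans_lt (ENNReal.mul_lt_top ENNReal.coe_lt_top hf.2)), hbound⟩
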